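/- **Setting.** Let $d\ge 1$ and let $\Lambda$ be a finite non-empty set of $n=|\Lambda|$ sites of the $d$-dimensional hypercubic lattice (each coordinate direction is either infinite or periodic), with the Manhattan distance. A spin $1/2$ sits on every site, so the Hilbert space is $(\mathbb C^2)^{\otimes n}$. Let $H=\sum_{i\in\Lambda}H_i$, where each $H_i$ is self-adjoint, $\|H_i\|\le 1$ (operator norm), and acts only on the spins $j$ with $\mathrm{dist}(i,j)\le \ell_0$. Let $\Omega=\sum_{i\in\Lambda}\Omega_i$, where each $\Omega_i$ is self-adjoint, $\|\Omega_i\|\le 1$, and acts only on the spins $j$ with $\mathrm{dist}(i,j)\le \ell$. Let $\rho_\beta=e^{-\beta H}/\mathrm{tr}\,e^{-\beta H}$ and $\langle A\rangle_\beta=\mathrm{tr}(\rho_\beta A)$. Let $E_m$, $|E_m\rangle$ be the eigenvalues (with multiplicity) and orthonormal eigenvectors of $H$, let $\mathcal N_{E,\Delta}$ be the number of $m$ with $E_m\in(E-\Delta,E]$, and let $\langle A\rangle_{E,\Delta}=\mathcal N_{E,\Delta}^{-1}\sum_{E_m\in(E-\Delta,E]}\langle E_m|A|E_m\rangle$. The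 state $\rho_\beta$ is $(r,\xi)$-clustering if $$|\langle A_XB_Y\rangle_\beta-\langle A_X\rangle_\beta\langle B_Y\rangle_\beta|\le\|A_X\|\,\|B_Y\|\,e^{-\mathrm{dist}(X,Y)/\xi}$$ for all operators $A_X,B_Y$ supported on non-empty $X,Y\subseteq\Lambda$ with $\mathrm{dist}(X,Y)\ge r$. **Theorem 2.** Fix $d\ge 1$, integers $r,\ell_0\ge 0$, $\xi>0$ and $\delta\in(0,1)$. Consider any system as above, any integer $\ell\ge r$, and any real $\beta$, $E$, $\Delta$ such that $E$ maximizes $E'\mapsto e^{-\beta E'}\mathcal N_{E',\Delta}$ over $\mathbb R$, $\rho_\beta$ is $(r,\xi)$-clustering, and $$0<\Delta\le(1-\delta)\sqrt n\qquad\text{and}\qquad\bigl(\Delta\le n^{(1-\delta)/2}\ \text{ or }\ \beta\Delta\le 1/\delta\bigr).\tag{$*$}$$ (a) There are constants $c_1',c_2'>0$, depending only on $d,r,\xi,\ell_0$ and $\delta$ (not on the lattice, $n$, $H$, $\Omega$, $\ell$, $\beta$, $E$, $\Delta$), such that always $$\left|\langle \Omega/n\rangle_{E,\Delta}-\langle\Omega/n\rangle_\beta\right|\le\frac1{\sqrt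 n}\max\Bigl(c_1'\bigl[\log(\sqrt n/\Delta)\bigr]^{(d+1)/2},\;c_2'\bigl[\ell^d\log(\sqrt n/\Delta)\bigr]^{1/2}\Bigr).$$ (b) Consequently the ensembles are equivalent down to widths $\Delta\sim\exp[-O(n^{1/(d+1)})]$: for every $\ell\ge r$ and $\varepsilon>0$ there are $a>0$ and $n_0$, depending only on $d,r,\xi,\ell_0,\delta,\ell,\varepsilon$, such that $\left|\langle \Omega/n\rangle_{E,\Delta}-\langle\Omega/n\rangle_\beta\right|\le\varepsilon$ whenever $n\ge n_0$ and $\Delta\ge\exp(-a\,n^{1/(d+1)})$. -/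

import Mathlib

open scoped Matrix.Norms.L2Operator

noncomputable section

/-- The sites of a `d`-dimensional hypercubic lattice.  As `ZMod 0 = ℤ`, the `k`-th direction is
infinite if `L k = 0`, and periodic with period `L k` otherwise. -/
abbrev Site {d : ℕ} (L : Fin d → ℕ) : Type := (k : Fin d) → ZMod (L k)

/-- The Manhattan distance; `ZMod.valMinAbs` is the representative of least absolute value. -/
def siteDist {d : ℕ} {L : Fin d → ℕ} (x y : Site L) : ℕ :=
  ∑ k, (x k - y k).valMinAbs.natAbs

/-- The configurations of the spins 1/2 on a finite set `Λ` of sites.  They label the standard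
orthonormal basis of the Hilbert space of the system. -/
abbrev Config {d : ℕ} {L : Fin d → ℕ} (Λ : Finset (Site L)) : Type := Λ → Fin 2

/-- The operators on the Hilbert space of the spins in `Λ`, with the operator norm. -/
abbrev Op {d : ℕ} {L : Fin d → ℕ} (Λ : Finset (Site L)) : Type :=
  Matrix (Config Λ) (Config Λ) ℂ

section System

variable {d : ℕ} {L : Fin d → ℕ} {Λ : Finset (Site L)}

open Classical in
/-- `A` is supported on `X`: it is of the form `B ⊗ 1`, with `B` acting on the spins in `X`. -/
def IsSupportedOn (A : Op Λ) (X : Set Λ) : Prop :=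
  ∃ B : Matrix (X → Fin 2) (X → Fin 2) ℂ, ∀ σ τ : Config Λ,
    A σ τ = if ∀ i, i ∉ X → σ i = τ i then B (fun i => σ i) (fun i => τ i) else 0

/-- A family of observables of norm at most one, the one at `i` acting only on the spins `j` with
`dist(i, j) ≤ s`. -/
structure IsLocalFamily (A : Λ → Op Λ) (s : ℕ) : Prop where
  isHermitian : ∀ i, (A i).IsHermitian
  norm_le : ∀ i, ‖A i‖ ≤ 1
  supported : ∀ i, IsSupportedOn (A i) {j | siteDist i.1 j.1 ≤ s}

theorem IsLocalFamily.isHermitian_sum {A : Λ → Op Λ} {s : ℕ} (hA : IsLocalFamily A s) :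
    (∑ i, A i).IsHermitian := by
  unfold Matrix.IsHermitian
  rw [Matrix.conjTranspose_sum]
  exact Finset.sum_congr rfl fun i _ => hA.isHermitian i

/-- The distance of two (non-empty) sets of spins. -/
def setDist (X Y : Set Λ) : ℕ :=
  sInf {m | ∃ i ∈ X, ∃ j ∈ Y, m = siteDist i.1 j.1}

/-- The average of the observable `A` in the state `ρ`. -/
def avg (ρ A : Op Λ) : ℂ := (ρ * A).trace

/-- `(r, ξ)`-clustering of the state `ρ`. -/
def IsClustering (r : ℕ) (ξ : ℝ) (ρ : Op Λ) : Prop :=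
  ∀ (X Y : Set Λ), X.Nonempty → Y.Nonempty → r ≤ setDist X Y →
    ∀ A B : Op Λ, IsSupportedOn A X → IsSupportedOn B Y →
      ‖avg ρ (A * B) - avg ρ A * avg ρ B‖ ≤ ‖A‖ * ‖B‖ * Real.exp (-(setDist X Y : ℝ) / ξ)

/-- The canonical state `exp(-βH) / Z_β`. -/
def canonicalState (H : Op Λ) (β : ℝ) : Op Λ :=
  (NormedSpace.exp (-(β : ℂ) • H)).trace⁻¹ • NormedSpace.exp (-(β : ℂ) • H)

open Classical in
/-- The labels of the eigenstates whose energy lies in the shell `(E - Δ, E]`. -/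
def shell {H : Op Λ} (hH : H.IsHermitian) (E Δ : ℝ) : Finset (Config Λ) :=
  {m | hH.eigenvalues m ∈ Set.Ioc (E - Δ) E}

/-- The number of eigenstates in the energy shell, with multiplicity. -/
def shellCount {H : Op Λ} (hH : H.IsHermitian) (E Δ : ℝ) : ℕ := (shell hH E Δ).card

/-- The microcanonical state: the normalized sum of `|E_m⟩⟨E_m|` over the energy shell. -/
def microState {H : Op Λ} (hH : H.IsHermitian) (E Δ : ℝ) : Op Λ :=
  (shellCount hH E Δ : ℂ)⁻¹ • ∑ m ∈ shell hH E Δ,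
    Matrix.vecMulVec (hH.eigenvectorBasis m).ofLp (star (hH.eigenvectorBasis m).ofLp)

/-- The energy `E` corresponds to the inverse temperature `β`: it maximizes
`E' ↦ exp(-β E') N_{E', Δ}` over the reals. -/
def IsShellMaximizer {H : Op Λ} (hH : H.IsHermitian) (β E Δ : ℝ) : Prop :=
  ∀ E' : ℝ, Real.exp (-β * E') * shellCount hH E' Δ ≤ Real.exp (-β * E) * shellCount hH E Δ

end System

/-- The energy widths under consideration for `n` spins at inverse temperature `β`: positive,
below `√n` by a fixed factor, and, unless below `√n` by a fixed power of `n`, at most of the order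
of the temperature. -/
def AdmissibleWidth (δ : ℝ) (n : ℕ) (β Δ : ℝ) : Prop :=
  0 < Δ ∧ Δ ≤ (1 - δ) * Real.sqrt n ∧ (Δ ≤ (n : ℝ) ^ ((1 - δ) / 2) ∨ β * Δ ≤ 1 / δ)

end

/-! The method is a comparison of high moments. Write `M = exp(-βE) N_{E,Δ}`, let `Z` be the
partition function, and let `A` be `Ω` minus its canonical average. A shell maximizer forces `β ≥
0`, and every level of the shell lies below `E`, so each of its states has Boltzmann weight at least
`exp(-βE)`. Convexity and positivity of even powers then give `|⟨A⟩_{E,Δ}|^(2p) ≤ (Z/M) ⟨A^(2p)⟩_β`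
(`avg_microState_pow_le`). It remains to bound the moment and the ratio `Z/M`, and to choose `p`.

Moments (`IsClustering.norm_avg_sum_pow_le`): expand `A^(2p)` into products of centred local terms.
If `D` is the least distance at which none of the `2p` sites of a product is isolated, some site is
at distance at least `D` from all others, and clustering gives decay in `D`. Joining sites at
distance at most `D` gives a graph without isolated vertices, so `p` of the sites dominate the rest.
The decay can be shared among the other `p` sites, each tied to a dominating one. Only `p` sites
then range freely over the lattice, whence a bound of order `(n p (ℓ + p)^d)^p`.

Ratio (`partitionFunction_le_of_isClustering`): the second moment of `H` and Chebyshev's inequality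
put half of `Z` into an energy window of width of order `√n`, covered by about `√n/Δ` shells. By
maximality each shell carries at most `(1 + n) M` and also at most `exp(βΔ) M`. With `q =
log(√n/Δ)`, the two alternatives for the width turn this into `Z/M ≤ C exp((1 + 2/δ) q)`.

Finally take `p` a power of two of order `q`: the root of `Z/M` stays bounded, and the squared
deviation of `Ω` is of order `n q max(ℓ, q)^d`. Part (b) follows because `q` is a small multiple of
`n^(1/(d+1))` for the widths allowed there. -/

section Lattice

/-! ### The Manhattan metric. -/

variable {d : ℕ} {L : Fin d → ℕ}

theorem siteDist_self (x : Site L) : siteDist x x = 0 := by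
  simp [siteDist]

theorem siteDist_comm (x y : Site L) : siteDist x y = siteDist y x := by
  unfold siteDist
  refine Finset.sum_congr rfl fun k _ => ?_
  rw [← ZMod.natAbs_valMinAbs_neg, neg_sub]

theorem siteDist_triangle (x y z : Site L) : siteDist x z ≤ siteDist x y + siteDist y z := by
  unfold siteDist
  rw [← Finset.sum_add_distrib]
  refine Finset.sum_le_sum fun k _ => ?_
  have h := ZMod.natAbs_valMinAbs_add_le (x k - y k) (y k - z k)
  rw [sub_add_sub_cancel] at h
  exact h.trans (Int.natAbs_add_le _ _)

end Lattice

/-! ### Algebra of operators with given support. -/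

section Support

variable {d : ℕ} {L : Fin d → ℕ} {Λ : Finset (Site L)}

/-- Entrywise description of the operators `B ⊗ 1`. -/
theorem isSupportedOn_iff {A : Op Λ} {X : Set Λ} :
    IsSupportedOn A X ↔
      (∀ σ τ : Config Λ, A σ τ ≠ 0 → ∀ i, i ∉ X → σ i = τ i) ∧
      (∀ σ τ σ' τ' : Config Λ, (∀ i ∈ X, σ i = σ' i) → (∀ i ∈ X, τ i = τ' i) →
        (∀ i, i ∉ X → σ i = τ i) → (∀ i, i ∉ X → σ' i = τ' i) → A σ τ = A σ' τ') := by
  classical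
  constructor
  · rintro ⟨B, hB⟩
    refine ⟨fun σ τ h => ?_, fun σ τ σ' τ' h1 h2 h3 h4 => ?_⟩
    · by_contra hc
      exact h (by rw [hB, if_neg hc])
    · rw [hB, hB, if_pos h3, if_pos h4]
      congr 1
      · funext i; exact h1 i i.2
      · funext i; exact h2 i i.2
  · rintro ⟨h1, h2⟩
    refine ⟨fun u v => A (fun i => if hi : i ∈ X then u ⟨i, hi⟩ else 0)
      (fun i => if hi : i ∈ X then v ⟨i, hi⟩ else 0), fun σ τ => ?_⟩
    split_ifs with h
    · apply h2 _ _ _ _ _ _ h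
      · intro i hi; simp [hi]
      · intro i hi; simp [hi]
      · intro i hi; simp [hi]
    · by_contra hc
      exact h (h1 σ τ hc)

theorem IsSupportedOn.mono {A : Op Λ} {X Y : Set Λ} (hA : IsSupportedOn A X) (hXY : X ⊆ Y) :
    IsSupportedOn A Y := by
  rw [isSupportedOn_iff] at hA ⊢
  obtain ⟨h1, h2⟩ := hA
  refine ⟨fun σ τ h i hi => h1 σ τ h i fun hX => hi (hXY hX), fun σ τ σ' τ' e1 e2 e3 e4 => ?_⟩
  -- Inside `Y` the two pairs of configurations coincide, and outside `Y` both pairs agree, so the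
  -- entries vanish for the same reason or not at all.
  have key : (∀ i, i ∉ X → σ i = τ i) ↔ (∀ i, i ∉ X → σ' i = τ' i) := by
    refine forall_congr' fun i => imp_congr_right fun _ => ?_
    by_cases hi : i ∈ Y
    · rw [e1 i hi, e2 i hi]
    · exact iff_of_true (e3 i hi) (e4 i hi)
  by_cases h : ∀ i, i ∉ X → σ i = τ i
  · exact h2 _ _ _ _ (fun i hi => e1 i (hXY hi)) (fun i hi => e2 i (hXY hi)) h (key.1 h)
  · have hz : A σ τ = 0 := by
      by_contra hc
      exact h (h1 _ _ hc)
    have hz' : A σ' τ' = 0 := by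
      by_contra hc
      exact h (key.2 (h1 _ _ hc))
    rw [hz, hz']

theorem isSupportedOn_smul_one (c : ℂ) (X : Set Λ) : IsSupportedOn (c • (1 : Op Λ)) X := by
  rw [isSupportedOn_iff]
  refine ⟨fun σ τ h i _ => ?_, fun σ τ σ' τ' e1 e2 e3 e4 => ?_⟩
  · by_contra hc
    have : σ ≠ τ := fun h => hc (by rw [h])
    simp [this] at h
  · have : σ = τ ↔ σ' = τ' := by
      simp only [funext_iff]
      refine forall_congr' fun i => ?_
      by_cases hi : i ∈ X
      · rw [e1 i hi, e2 i hi]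
      · exact iff_of_true (e3 i hi) (e4 i hi)
    simp [Matrix.one_apply, this]

theorem isSupportedOn_one (X : Set Λ) : IsSupportedOn (1 : Op Λ) X := by
  simpa using isSupportedOn_smul_one (1 : ℂ) X

theorem IsSupportedOn.sub {A B : Op Λ} {X : Set Λ} (hA : IsSupportedOn A X)
    (hB : IsSupportedOn B X) : IsSupportedOn (A - B) X := by
  classical
  obtain ⟨A', hA'⟩ := hA
  obtain ⟨B', hB'⟩ := hB
  refine ⟨A' - B', fun σ τ => ?_⟩
  rw [Matrix.sub_apply, hA', hB']
  split_ifs <;> simp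

open Classical in
/-- The configuration that agrees with `σ` on `X` and with `τ` elsewhere. -/
noncomputable def Config.merge (X : Set Λ) (σ τ : Config Λ) : Config Λ :=
  fun i => if i ∈ X then σ i else τ i

theorem Config.merge_of_mem {X : Set Λ} {σ τ : Config Λ} {i : Λ} (hi : i ∈ X) :
    Config.merge X σ τ i = σ i := by simp [Config.merge, hi]

theorem Config.merge_of_notMem {X : Set Λ} {σ τ : Config Λ} {i : Λ} (hi : i ∉ X) :
    Config.merge X σ τ i = τ i := by simp [Config.merge, hi]

theorem IsSupportedOn.mul {A B : Op Λ} {X : Set Λ} (hA : IsSupportedOn A X)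
    (hB : IsSupportedOn B X) : IsSupportedOn (A * B) X := by
  classical
  rw [isSupportedOn_iff] at hA hB ⊢
  obtain ⟨a1, a2⟩ := hA
  obtain ⟨b1, b2⟩ := hB
  refine ⟨fun σ τ h i hi => ?_, fun σ τ σ' τ' e1 e2 e3 e4 => ?_⟩
  · rw [Matrix.mul_apply] at h
    obtain ⟨υ, -, hυ⟩ := Finset.exists_ne_zero_of_sum_ne_zero h
    rw [a1 σ υ (left_ne_zero_of_mul hυ) i hi, b1 υ τ (right_ne_zero_of_mul hυ) i hi]
  · simp only [Matrix.mul_apply]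
    -- In a nonzero term the intermediate configuration is already fixed off `X`; resetting it there
    -- to `σ'` matches the nonzero terms of the two sums.
    refine Finset.sum_bij_ne_zero (fun υ _ _ => Config.merge X υ σ') (fun _ _ _ => Finset.mem_univ _)
      ?_ ?_ ?_
    · intro υ _ hυ υ' _ hυ' h
      funext i
      by_cases hi : i ∈ X
      · have := congrFun h i
        rwa [Config.merge_of_mem hi, Config.merge_of_mem hi] at this
      · rw [← a1 σ υ (left_ne_zero_of_mul hυ) i hi, ← a1 σ υ' (left_ne_zero_of_mul hυ') i hi]
    · intro υ _ hυ
      have hA' : ∀ i, i ∉ X → σ' i = υ i := fun i hi => a1 _ _ (left_ne_zero_of_mul hυ) i hi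
      have h1 : A σ (Config.merge X υ σ) = A σ' υ :=
        a2 _ _ _ _ e1 (fun i hi => Config.merge_of_mem hi)
          (fun i hi => (Config.merge_of_notMem hi).symm) hA'
      have h2 : B (Config.merge X υ σ) τ = B υ τ' :=
        b2 _ _ _ _ (fun i hi => Config.merge_of_mem hi) e2
          (fun i hi => by rw [Config.merge_of_notMem hi, e3 i hi])
          (fun i hi => b1 _ _ (right_ne_zero_of_mul hυ) i hi)
      refine ⟨Config.merge X υ σ, Finset.mem_univ _, by rwa [h1, h2], ?_⟩
      funext i
      by_cases hi : i ∈ X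
      · simp only [Config.merge_of_mem hi]
      · rw [Config.merge_of_notMem hi, hA' i hi]
    · intro υ _ hυ
      have hA' : ∀ i, i ∉ X → σ i = υ i := fun i hi => a1 _ _ (left_ne_zero_of_mul hυ) i hi
      rw [a2 σ υ σ' (Config.merge X υ σ') e1 (fun i hi => (Config.merge_of_mem hi).symm) hA'
          (fun i hi => (Config.merge_of_notMem hi).symm),
        b2 υ τ (Config.merge X υ σ') τ' (fun i hi => (Config.merge_of_mem hi).symm) e2
          (fun i hi => b1 _ _ (right_ne_zero_of_mul hυ) i hi)
          (fun i hi => by rw [Config.merge_of_notMem hi, e4 i hi])]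

/-- A single intermediate configuration survives: `A` forces it to equal `σ` off `X`, and `B` forces
it to equal `τ` off `Y`, in particular on `X`. -/
theorem IsSupportedOn.mul_apply_of_disjoint {A B : Op Λ} {X Y : Set Λ} (hA : IsSupportedOn A X)
    (hB : IsSupportedOn B Y) (hXY : Disjoint X Y) (σ τ : Config Λ) :
    (A * B) σ τ = A σ (Config.merge X τ σ) * B (Config.merge X τ σ) τ := by
  rw [Matrix.mul_apply]
  rw [isSupportedOn_iff] at hA hB
  refine Finset.sum_eq_single _ (fun υ _ hυ => ?_) (fun h => (h (Finset.mem_univ _)).elim)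
  by_contra hc
  refine hυ (funext fun i => ?_)
  by_cases hi : i ∈ X
  · rw [Config.merge_of_mem hi]
    exact hB.1 _ _ (right_ne_zero_of_mul hc) i (Set.disjoint_left.1 hXY hi)
  · rw [Config.merge_of_notMem hi]
    exact (hA.1 _ _ (left_ne_zero_of_mul hc) i hi).symm

theorem IsSupportedOn.commute {A B : Op Λ} {X Y : Set Λ} (hA : IsSupportedOn A X)
    (hB : IsSupportedOn B Y) (hXY : Disjoint X Y) : Commute A B := by
  have hAc := hA
  have hBc := hB.mono (Set.subset_compl_iff_disjoint_left.2 hXY)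
  ext σ τ
  rw [hA.mul_apply_of_disjoint hBc disjoint_compl_right,
    hBc.mul_apply_of_disjoint hA disjoint_compl_left, mul_comm]
  rw [isSupportedOn_iff] at hA hBc
  congr 1
  · refine hBc.2 _ _ _ _ (fun i hi => ?_) (fun i hi => ?_) (fun i hi => ?_) fun i hi => ?_
    · exact Config.merge_of_notMem hi
    · exact (Config.merge_of_mem hi).symm
    · exact Config.merge_of_mem (not_not.1 hi)
    · exact (Config.merge_of_notMem hi).symm
  · refine hA.2 _ _ _ _ (fun i hi => ?_) (fun i hi => ?_) (fun i hi => ?_) fun i hi => ?_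
    · exact (Config.merge_of_notMem (not_not.2 hi)).symm
    · exact Config.merge_of_mem hi
    · exact (Config.merge_of_notMem hi).symm
    · exact Config.merge_of_mem hi

theorem isSupportedOn_list_prod {l : List (Op Λ)} {X : Set Λ}
    (h : ∀ A ∈ l, IsSupportedOn A X) : IsSupportedOn l.prod X := by
  induction l with
  | nil => exact isSupportedOn_one X
  | cons A l ih =>
    rw [List.prod_cons]
    exact (h A (by simp)).mul (ih fun B hB => h B (by simp [hB]))

theorem le_setDist {X Y : Set Λ} (hX : X.Nonempty) (hY : Y.Nonempty) {m : ℕ}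
    (h : ∀ i ∈ X, ∀ j ∈ Y, m ≤ siteDist i.1 j.1) : m ≤ setDist X Y := by
  obtain ⟨i, hi⟩ := hX
  obtain ⟨j, hj⟩ := hY
  refine le_csInf ⟨_, i, hi, j, hj, rfl⟩ ?_
  rintro _ ⟨i, hi, j, hj, rfl⟩
  exact h i hi j hj

end Support

/-! ### Averages in the eigenvectors of a Hermitian matrix. -/

section EigenMean

variable {ι : Type*} [Fintype ι] [DecidableEq ι] {H : Matrix ι ι ℂ}

/-- The average of `A` in the `m`-th eigenvector of `H`. -/
noncomputable def eigenMean (hH : H.IsHermitian) (m : ι) (A : Matrix ι ι ℂ) : ℂ :=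
  (star (hH.eigenvectorUnitary : Matrix ι ι ℂ) * A * hH.eigenvectorUnitary) m m

theorem eigenMean_eq_dotProduct (hH : H.IsHermitian) (m : ι) (A : Matrix ι ι ℂ) :
    eigenMean hH m A = dotProduct (star (hH.eigenvectorBasis m).ofLp)
      (Matrix.mulVec A (hH.eigenvectorBasis m).ofLp) := by
  rw [eigenMean, mul_assoc, Matrix.mul_apply]
  refine Finset.sum_congr rfl fun i _ => ?_
  congr 1

theorem eigenMean_eq_trace (hH : H.IsHermitian) (m : ι) (A : Matrix ι ι ℂ) :
    eigenMean hH m A = (Matrix.vecMulVec (hH.eigenvectorBasis m).ofLp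
      (star (hH.eigenvectorBasis m).ofLp) * A).trace := by
  rw [eigenMean_eq_dotProduct, Matrix.vecMulVec_mul, Matrix.trace_vecMulVec,
    Matrix.dotProduct_mulVec, dotProduct_comm]

theorem eigenMean_one (hH : H.IsHermitian) (m : ι) : eigenMean hH m 1 = 1 := by
  simp [eigenMean]

theorem norm_apply_le_l2_opNorm (A : Matrix ι ι ℂ) (i j : ι) : ‖A i j‖ ≤ ‖A‖ := by
  have h := Matrix.l2_opNorm_mulVec A (EuclideanSpace.single j (1 : ℂ))
  rw [PiLp.norm_single, norm_one, mul_one] at h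
  refine le_trans ?_ h
  refine le_trans (le_of_eq ?_) (PiLp.norm_apply_le _ i)
  simp

theorem norm_eigenMean_le (hH : H.IsHermitian) (m : ι) (A : Matrix ι ι ℂ) :
    ‖eigenMean hH m A‖ ≤ ‖A‖ := by
  refine (norm_apply_le_l2_opNorm _ m m).trans (le_of_eq ?_)
  rw [CStarRing.norm_mul_coe_unitary, ← Unitary.coe_star, CStarRing.norm_coe_unitary_mul]

theorem eigenMean_im (hH : H.IsHermitian) (m : ι) {A : Matrix ι ι ℂ} (hA : A.IsHermitian) :
    (eigenMean hH m A).im = 0 := by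
  have h := Matrix.isHermitian_conjTranspose_mul_mul (hH.eigenvectorUnitary : Matrix ι ι ℂ) hA
  have := h.apply m m
  rw [← Complex.conj_eq_iff_im]
  exact this

/-- In the eigenbasis a diagonal entry of the square is the sum of the squared moduli of a row, one
of which is that of the diagonal entry. -/
theorem eigenMean_sq_re_ge (hH : H.IsHermitian) (m : ι) {A : Matrix ι ι ℂ} (hA : A.IsHermitian) :
    (eigenMean hH m A).re ^ 2 ≤ (eigenMean hH m (A ^ 2)).re := by
  set M : Matrix ι ι ℂ :=
    star (hH.eigenvectorUnitary : Matrix ι ι ℂ) * A * hH.eigenvectorUnitary with hM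
  have hMh : M.IsHermitian := Matrix.isHermitian_conjTranspose_mul_mul _ hA
  have hsq : star (hH.eigenvectorUnitary : Matrix ι ι ℂ) * (A ^ 2) * hH.eigenvectorUnitary
      = M * M := by
    have hU : (hH.eigenvectorUnitary : Matrix ι ι ℂ) * star (hH.eigenvectorUnitary : Matrix ι ι ℂ)
      = 1 := Unitary.coe_mul_star_self _
    rw [hM, pow_two]
    simp only [mul_assoc]
    rw [← mul_assoc (hH.eigenvectorUnitary : Matrix ι ι ℂ)
      (star (hH.eigenvectorUnitary : Matrix ι ι ℂ)), hU, one_mul]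
  have hterm : ∀ k, (M m k * M k m).re = Complex.normSq (M m k) := fun k => by
    rw [← hMh.apply k m, Complex.star_def, Complex.mul_conj, Complex.ofReal_re]
  rw [eigenMean, eigenMean, hsq, ← hM, Matrix.mul_apply, Complex.re_sum]
  simp only [hterm]
  refine le_trans ?_ (Finset.single_le_sum (f := fun k => Complex.normSq (M m k))
    (fun k _ => Complex.normSq_nonneg _) (Finset.mem_univ m))
  rw [Complex.normSq_apply]
  nlinarith [mul_self_nonneg (M m m).im]

/-- Iterating the case of squares avoids the spectral measure of `A`, at the price of reaching
exponents that are powers of two only. -/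
theorem eigenMean_pow_two_pow_re_ge (hH : H.IsHermitian) (m : ι) {A : Matrix ι ι ℂ}
    (hA : A.IsHermitian) (k : ℕ) :
    (eigenMean hH m A).re ^ 2 ^ (k + 1) ≤ (eigenMean hH m (A ^ 2 ^ (k + 1))).re := by
  induction k with
  | zero => simpa using eigenMean_sq_re_ge hH m hA
  | succ k ih =>
    rw [pow_succ 2 (k + 1), pow_mul, pow_mul]
    refine le_trans (pow_le_pow_left₀ ?_ ih 2) (eigenMean_sq_re_ge hH m (hA.pow _))
    exact (even_two.pow_of_ne_zero (Nat.succ_ne_zero k)).pow_nonneg _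

theorem eigenMean_pow_two_pow_re_nonneg (hH : H.IsHermitian) (m : ι) {A : Matrix ι ι ℂ}
    (hA : A.IsHermitian) (k : ℕ) : 0 ≤ (eigenMean hH m (A ^ 2 ^ (k + 1))).re :=
  le_trans ((even_two.pow_of_ne_zero (Nat.succ_ne_zero k)).pow_nonneg _)
    (eigenMean_pow_two_pow_re_ge hH m hA k)

theorem trace_exp_smul_mul (hH : H.IsHermitian) (β : ℝ) (A : Matrix ι ι ℂ) :
    (NormedSpace.exp (-(β : ℂ) • H) * A).trace =
      ∑ m, (Real.exp (-β * hH.eigenvalues m) : ℂ) * eigenMean hH m A := by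
  set U : Matrix ι ι ℂ := ↑hH.eigenvectorUnitary with hU
  have hUU : U * star U = 1 := Unitary.coe_mul_star_self _
  have hUinv : U⁻¹ = star U := Matrix.inv_eq_right_inv hUU
  have hUunit : IsUnit U := by
    rw [Matrix.isUnit_iff_isUnit_det]
    exact (Matrix.isUnit_det_of_right_inverse hUU)
  have hspec : -(β : ℂ) • H =
      U * Matrix.diagonal (fun m => (-(β : ℂ) * (hH.eigenvalues m : ℂ))) * U⁻¹ := by
    have h := hH.spectral_theorem
    rw [Unitary.conjStarAlgAut_apply] at h
    conv_lhs => rw [h]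
    rw [hUinv, ← smul_mul_assoc, ← mul_smul_comm, ← Matrix.diagonal_smul]
    rfl
  rw [hspec, Matrix.exp_conj _ _ hUunit, Matrix.exp_diagonal, hUinv, mul_assoc, mul_assoc,
    Matrix.trace_mul_comm, mul_assoc, Matrix.trace]
  refine Finset.sum_congr rfl fun m _ => ?_
  rw [Matrix.diag_apply, Matrix.diagonal_mul, eigenMean, ← hU, Pi.coe_exp,
    ← Complex.exp_eq_exp_ℂ]
  push_cast
  rfl

theorem eigenMean_sub_smul_one_sq (hH : H.IsHermitian) (m : ι) (c : ℝ) :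
    eigenMean hH m ((H - (c : ℂ) • 1) ^ 2) = ((hH.eigenvalues m - c) ^ 2 : ℝ) := by
  set U : Matrix ι ι ℂ := ↑hH.eigenvectorUnitary with hU
  have hUU : U * star U = 1 := Unitary.coe_mul_star_self _
  have hU' : star U * U = 1 := Unitary.coe_star_mul_self _
  have h := hH.conjStarAlgAut_star_eigenvectorUnitary
  rw [Unitary.conjStarAlgAut_star_apply] at h
  have hd : star U * (H - (c : ℂ) • 1) * U =
      Matrix.diagonal (fun m => (hH.eigenvalues m : ℂ) - c) := by
    rw [mul_sub, sub_mul, h, mul_smul_comm, smul_mul_assoc, mul_one, hU',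
      Matrix.smul_one_eq_diagonal, Matrix.diagonal_sub]
    rfl
  have hsq : star U * (H - (c : ℂ) • 1) ^ 2 * U =
      (star U * (H - (c : ℂ) • 1) * U) * (star U * (H - (c : ℂ) • 1) * U) := by
    rw [pow_two]
    simp only [mul_assoc]
    rw [← mul_assoc U (star U), hUU, one_mul]
  rw [eigenMean, ← hU, hsq, hd, Matrix.diagonal_mul_diagonal, Matrix.diagonal_apply_eq]
  push_cast
  ring

end EigenMean

/-! ### Canonical and microcanonical states, and their comparison. -/

section States

variable {d : ℕ} {L : Fin d → ℕ} {Λ : Finset (Site L)} {H : Op Λ}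

theorem avg_sub (ρ A B : Op Λ) : avg ρ (A - B) = avg ρ A - avg ρ B := by
  simp [avg, mul_sub]

theorem avg_smul (ρ A : Op Λ) (c : ℂ) : avg ρ (c • A) = c * avg ρ A := by
  simp [avg]

theorem avg_sum (ρ : Op Λ) {κ : Type*} (s : Finset κ) (A : κ → Op Λ) :
    avg ρ (∑ i ∈ s, A i) = ∑ i ∈ s, avg ρ (A i) := by
  simp [avg, Finset.mul_sum, Matrix.trace_sum]

/-- The canonical partition function. -/
noncomputable def partitionFunction (hH : H.IsHermitian) (β : ℝ) : ℝ :=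
  ∑ m, Real.exp (-β * hH.eigenvalues m)

theorem partitionFunction_pos (hH : H.IsHermitian) (β : ℝ) : 0 < partitionFunction hH β :=
  Finset.sum_pos (fun _ _ => Real.exp_pos _) Finset.univ_nonempty

theorem avg_canonicalState (hH : H.IsHermitian) (β : ℝ) (A : Op Λ) :
    avg (canonicalState H β) A =
      ∑ m, (Real.exp (-β * hH.eigenvalues m) / partitionFunction hH β : ℝ) * eigenMean hH m A := by
  have hZ : (NormedSpace.exp (-(β : ℂ) • H)).trace = (partitionFunction hH β : ℂ) := by
    have := trace_exp_smul_mul hH β 1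
    simp only [mul_one, eigenMean_one] at this
    rw [this, partitionFunction, Complex.ofReal_sum]
  rw [avg, canonicalState, hZ, smul_mul_assoc, Matrix.trace_smul, trace_exp_smul_mul hH,
    smul_eq_mul, Finset.mul_sum]
  refine Finset.sum_congr rfl fun m _ => ?_
  push_cast
  ring

theorem sum_gibbs_weight (hH : H.IsHermitian) (β : ℝ) :
    ∑ m, Real.exp (-β * hH.eigenvalues m) / partitionFunction hH β = 1 := by
  rw [← Finset.sum_div]
  exact div_self (partitionFunction_pos hH β).ne'

theorem avg_canonicalState_one (hH : H.IsHermitian) (β : ℝ) :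
    avg (canonicalState H β) 1 = 1 := by
  rw [avg_canonicalState hH]
  simp only [eigenMean_one, mul_one]
  rw [← Complex.ofReal_sum, sum_gibbs_weight, Complex.ofReal_one]

theorem norm_avg_canonicalState_le (hH : H.IsHermitian) (β : ℝ) (A : Op Λ) :
    ‖avg (canonicalState H β) A‖ ≤ ‖A‖ := by
  rw [avg_canonicalState hH]
  have hw : ∀ m, 0 ≤ Real.exp (-β * hH.eigenvalues m) / partitionFunction hH β := fun m =>
    div_nonneg (Real.exp_pos _).le (partitionFunction_pos hH β).le
  calc _ ≤ ∑ m, Real.exp (-β * hH.eigenvalues m) / partitionFunction hH β * ‖A‖ := by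
        refine norm_sum_le_of_le _ fun m _ => ?_
        rw [norm_mul, Complex.norm_real, Real.norm_of_nonneg (hw m)]
        exact mul_le_mul_of_nonneg_left (norm_eigenMean_le hH m A) (hw m)
    _ = ‖A‖ := by rw [← Finset.sum_mul, sum_gibbs_weight, one_mul]

theorem avg_canonicalState_im (hH : H.IsHermitian) (β : ℝ) {A : Op Λ} (hA : A.IsHermitian) :
    (avg (canonicalState H β) A).im = 0 := by
  rw [avg_canonicalState hH, Complex.im_sum]
  refine Finset.sum_eq_zero fun m _ => ?_
  rw [Complex.im_ofReal_mul, eigenMean_im hH m hA, mul_zero]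

theorem avg_canonicalState_re (hH : H.IsHermitian) (β : ℝ) (A : Op Λ) :
    (avg (canonicalState H β) A).re =
      ∑ m, Real.exp (-β * hH.eigenvalues m) / partitionFunction hH β * (eigenMean hH m A).re := by
  rw [avg_canonicalState hH, Complex.re_sum]
  simp only [Complex.re_ofReal_mul]

theorem avg_microState (hH : H.IsHermitian) (E Δ : ℝ) (A : Op Λ) :
    avg (microState hH E Δ) A = (shellCount hH E Δ : ℂ)⁻¹ *
      ∑ m ∈ shell hH E Δ, eigenMean hH m A := by
  rw [avg, microState, smul_mul_assoc, Matrix.trace_smul, Finset.sum_mul, Matrix.trace_sum,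
    smul_eq_mul]
  simp only [eigenMean_eq_trace]

theorem avg_microState_one (hH : H.IsHermitian) {E Δ : ℝ} (h : shellCount hH E Δ ≠ 0) :
    avg (microState hH E Δ) 1 = 1 := by
  rw [avg_microState]
  simp only [eigenMean_one, Finset.sum_const, nsmul_eq_mul, mul_one]
  exact inv_mul_cancel₀ (Nat.cast_ne_zero.2 h)

/-- A power of the microcanonical average is controlled by the canonical average of the power. -/
theorem avg_microState_pow_le (hH : H.IsHermitian) {β E Δ : ℝ} (hβ : 0 ≤ β)
    (hN : shellCount hH E Δ ≠ 0) {A : Op Λ} (hA : A.IsHermitian) (k : ℕ) :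
    ‖avg (microState hH E Δ) A‖ ^ 2 ^ (k + 1) ≤
      partitionFunction hH β / (Real.exp (-β * E) * shellCount hH E Δ) *
        (avg (canonicalState H β) (A ^ 2 ^ (k + 1))).re := by
  have hZ := partitionFunction_pos hH β
  have hN' : (0 : ℝ) < shellCount hH E Δ := Nat.cast_pos.2 (Nat.pos_of_ne_zero hN)
  have heven : Even (2 ^ (k + 1)) := even_two.pow_of_ne_zero (Nat.succ_ne_zero k)
  have hval : avg (microState hH E Δ) A =
      ((∑ m ∈ shell hH E Δ, (shellCount hH E Δ : ℝ)⁻¹ * (eigenMean hH m A).re : ℝ) : ℂ) := by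
    rw [avg_microState, Finset.mul_sum, Complex.ofReal_sum]
    refine Finset.sum_congr rfl fun m _ => ?_
    rw [Complex.ofReal_mul, Complex.ofReal_inv, Complex.ofReal_natCast]
    congr 1
    exact (Complex.ext (by simp) (by simp [eigenMean_im hH m hA]))
  rw [hval, Complex.norm_real, Real.norm_eq_abs, heven.pow_abs]
  have hsum : ∑ m ∈ shell hH E Δ, (shellCount hH E Δ : ℝ)⁻¹ = 1 := by
    rw [Finset.sum_const, nsmul_eq_mul]
    exact mul_inv_cancel₀ hN'.ne'
  refine (Real.pow_arith_mean_le_arith_mean_pow_of_even _ _ _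
    (fun _ _ => inv_nonneg.2 hN'.le) hsum heven).trans ?_
  rw [avg_canonicalState_re hH, Finset.mul_sum]
  -- Termwise the uniform weight is dominated by the rescaled Boltzmann weight, as `E` is the top of
  -- the shell and `β ≥ 0`. The sum then extends to the whole spectrum because means of even powers
  -- are nonnegative.
  refine (Finset.sum_le_sum fun m hm => ?_).trans
    (Finset.sum_le_sum_of_subset_of_nonneg (Finset.subset_univ (shell hH E Δ)) fun m _ _ => ?_)
  · have hmE : hH.eigenvalues m ≤ E := by
      simp only [shell, Finset.mem_filter, Set.mem_Ioc] at hm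
      exact hm.2.2
    have h0 := eigenMean_pow_two_pow_re_nonneg hH m hA k
    refine (mul_le_mul_of_nonneg_left (eigenMean_pow_two_pow_re_ge hH m hA k)
      (inv_nonneg.2 hN'.le)).trans ?_
    rw [← mul_assoc]
    refine mul_le_mul_of_nonneg_right ?_ h0
    have hexp : Real.exp (-β * E) ≤ Real.exp (-β * hH.eigenvalues m) :=
      Real.exp_le_exp.2 (by nlinarith)
    rw [div_mul_div_comm, mul_comm (partitionFunction hH β), mul_div_mul_right _ _ hZ.ne',
      inv_eq_one_div, div_le_div_iff₀ hN' (by positivity)]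
    nlinarith
  · refine mul_nonneg (by positivity) (mul_nonneg (div_nonneg (Real.exp_pos _).le hZ.le)
      (eigenMean_pow_two_pow_re_nonneg hH m hA k))

theorem shellCount_ne_zero_of_isShellMaximizer {hH : H.IsHermitian} {β E Δ : ℝ} (hΔ : 0 < Δ)
    (h : IsShellMaximizer hH β E Δ) : shellCount hH E Δ ≠ 0 := by
  intro h0
  have m : Config Λ := fun _ => 0
  have h1 := h (hH.eigenvalues m)
  rw [h0, Nat.cast_zero, mul_zero] at h1
  have h2 : 0 < shellCount hH (hH.eigenvalues m) Δ :=
    Finset.card_pos.2 ⟨m, by simp [shell, hΔ]⟩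
  have h3 : (0 : ℝ) < shellCount hH (hH.eigenvalues m) Δ := Nat.cast_pos.2 h2
  have := mul_pos (Real.exp_pos (-β * hH.eigenvalues m)) h3
  linarith

/-- As the number of states in a shell is a right-continuous step function of its upper end, there
is no maximizer at negative inverse temperature. -/
theorem nonneg_of_isShellMaximizer {hH : H.IsHermitian} {β E Δ : ℝ} (hΔ : 0 < Δ)
    (h : IsShellMaximizer hH β E Δ) : 0 ≤ β := by
  by_contra! hβ
  have hN := shellCount_ne_zero_of_isShellMaximizer hΔ h
  have hN' : (0 : ℝ) < shellCount hH E Δ := Nat.cast_pos.2 (Nat.pos_of_ne_zero hN)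
  have hne : (shell hH E Δ).Nonempty := Finset.card_pos.1 (Nat.pos_of_ne_zero hN)
  obtain ⟨m₀, hm₀, hmin⟩ := Finset.exists_min_image (shell hH E Δ) hH.eigenvalues hne
  simp only [shell, Finset.mem_filter, Finset.mem_univ, true_and, Set.mem_Ioc] at hm₀ hmin
  -- Half the gap between the lowest level in the shell and its open lower end: raising the shell by
  -- `η` loses no state, while for `β < 0` the exponential factor grows strictly.
  set η := (hH.eigenvalues m₀ - (E - Δ)) / 2 with hη
  have hη0 : 0 < η := by rw [hη]; linarith
  have hsub : shell hH E Δ ⊆ shell hH (E + η) Δ := by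
    intro m hm
    simp only [shell, Finset.mem_filter, Finset.mem_univ, true_and, Set.mem_Ioc] at hm ⊢
    have := hmin m hm
    constructor <;> linarith [hm.1, hm.2]
  have hcard : (shellCount hH E Δ : ℝ) ≤ shellCount hH (E + η) Δ :=
    Nat.cast_le.2 (Finset.card_le_card hsub)
  have h1 := h (E + η)
  have h2 : Real.exp (-β * E) < Real.exp (-β * (E + η)) := Real.exp_lt_exp.2 (by nlinarith)
  have h3 : Real.exp (-β * E) * shellCount hH E Δ <
      Real.exp (-β * (E + η)) * shellCount hH (E + η) Δ :=
    mul_lt_mul h2 hcard hN' (Real.exp_pos _).le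
  linarith

end States

/-! ### Dominating sets and lattice sums. -/

section Combinatorics

/-- In a graph without isolated vertices, the complement of a minimal dominating set is dominating,
so that some dominating set contains half of the vertices. -/
theorem exists_dominating_card_eq {κ : Type*} [Fintype κ] [DecidableEq κ] {R : κ → κ → Prop}
    (hsymm : ∀ k j, R k j → R j k) (hR : ∀ k, ∃ j, j ≠ k ∧ R k j) {p : ℕ}
    (hp : Fintype.card κ = 2 * p) :
    ∃ S : Finset κ, S.card = p ∧ ∀ k, k ∉ S → ∃ j ∈ S, R k j := by
  classical
  suffices h : ∃ S : Finset κ, S.card ≤ p ∧ ∀ k, k ∉ S → ∃ j ∈ S, R k j by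
    obtain ⟨S, hS, hd⟩ := h
    obtain ⟨T, hST, hT⟩ := Finset.exists_superset_card_eq hS (by omega)
    refine ⟨T, hT, fun k hk => ?_⟩
    obtain ⟨j, hj, hkj⟩ := hd k fun h => hk (hST h)
    exact ⟨j, hST hj, hkj⟩
  obtain ⟨S, hS, hmin⟩ := Finset.exists_min_image
    (Finset.univ.filter fun S : Finset κ => ∀ k, k ∉ S → ∃ j ∈ S, R k j) Finset.card
    ⟨Finset.univ, by simp⟩
  simp only [Finset.mem_filter, Finset.mem_univ, true_and] at hS hmin
  rcases le_or_gt S.card p with h | h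
  · exact ⟨S, h, hS⟩
  · refine ⟨Sᶜ, by rw [Finset.card_compl]; omega, fun s hs => ?_⟩
    rw [Finset.mem_compl, not_not] at hs
    by_contra! hc
    have hnb : ∀ j, R s j → j ∈ S := fun j hj => by
      by_contra hjS
      exact hc j (Finset.mem_compl.2 hjS) hj
    -- If all neighbours of `s` lie in `S`, then `s` is superfluous: it has a neighbour other than
    -- itself, and by symmetry no vertex outside `S` relies on it.
    have hdom : ∀ k, k ∉ S.erase s → ∃ j ∈ S.erase s, R k j := by
      intro k hk
      by_cases hks : k = s
      · subst hks
        obtain ⟨j, hjk, hj⟩ := hR k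
        exact ⟨j, Finset.mem_erase.2 ⟨hjk, hnb j hj⟩, hj⟩
      · have hkS : k ∉ S := fun h => hk (Finset.mem_erase.2 ⟨hks, h⟩)
        obtain ⟨j, hj, hkj⟩ := hS k hkS
        refine ⟨j, Finset.mem_erase.2 ⟨?_, hj⟩, hkj⟩
        rintro rfl
        exact hkS (hnb k (hsymm _ _ hkj))
    have := hmin _ hdom
    have := Finset.card_erase_lt_of_mem hs
    omega

/-- Truncated subtraction makes the terms with `u ≤ m` equal to one. The others form a geometric
series with ratio `q = exp(-1/a)`, and `q/(1 - q) ≤ a` because `exp(1/a) ≥ 1 + 1/a`. -/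
theorem sum_exp_neg_nat_sub_le (U : Finset ℕ) (m : ℕ) {a : ℝ} (ha : 0 < a) :
    ∑ u ∈ U, Real.exp (-((u - m : ℕ) : ℝ) / a) ≤ m + 1 + a := by
  obtain ⟨K, hK⟩ : ∃ K, U ⊆ Finset.range (m + 1 + K) :=
    ⟨U.sup id, fun u hu => Finset.mem_range.2 (by
      have := Finset.le_sup (f := id) hu
      simp only [id] at this
      omega)⟩
  refine (Finset.sum_le_sum_of_subset_of_nonneg hK fun _ _ _ => (Real.exp_pos _).le).trans ?_
  rw [Finset.sum_range_add]
  refine add_le_add ?_ ?_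
  · refine (Finset.sum_le_card_nsmul _ _ 1 fun u _ => ?_).trans_eq (by simp)
    exact Real.exp_le_one_iff.2 (div_nonpos_of_nonpos_of_nonneg (by simp) ha.le)
  · set q := Real.exp (-1 / a) with hq
    have hq0 : 0 < q := Real.exp_pos _
    have hq1 : q < 1 := Real.exp_lt_one_iff.2 (div_neg_of_neg_of_pos (by norm_num) ha)
    have hterm : ∀ x : ℕ, Real.exp (-((m + 1 + x - m : ℕ) : ℝ) / a) = q * q ^ x := fun x => by
      rw [← pow_succ', hq, ← Real.exp_nat_mul]
      congr 1
      rw [show m + 1 + x - m = x + 1 by omega]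
      push_cast
      ring
    simp only [hterm]
    rw [← Finset.mul_sum]
    have hgeom : (∑ x ∈ Finset.range K, q ^ x) * (1 - q) ≤ 1 := by
      rw [geom_sum_mul_neg]
      linarith [pow_pos hq0 K]
    have hqa : q ≤ a * (1 - q) := by
      have h1 := Real.add_one_le_exp (1 / a)
      have h2 : q * Real.exp (1 / a) = 1 := by
        rw [hq, ← Real.exp_add, neg_div, neg_add_cancel, Real.exp_zero]
      have h3 : q * (1 / a + 1) ≤ 1 := (mul_le_mul_of_nonneg_left h1 hq0.le).trans_eq h2
      have h4 : q * (1 / a + 1) * a = q + q * a := by field_simp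
      nlinarith
    have h0 : 0 ≤ ∑ x ∈ Finset.range K, q ^ x := Finset.sum_nonneg fun _ _ => by positivity
    calc q * ∑ x ∈ Finset.range K, q ^ x
        ≤ a * (1 - q) * ∑ x ∈ Finset.range K, q ^ x := mul_le_mul_of_nonneg_right hqa h0
      _ = a * ((∑ x ∈ Finset.range K, q ^ x) * (1 - q)) := by ring
      _ ≤ a * 1 := mul_le_mul_of_nonneg_left hgeom ha.le
      _ = a := mul_one a

theorem sum_exp_neg_natAbs_sub_le (T : Finset ℤ) (m : ℕ) {a : ℝ} (ha : 0 < a) :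
    ∑ z ∈ T, Real.exp (-((z.natAbs - m : ℕ) : ℝ) / a) ≤ 2 * (m + 1 + a) := by
  rw [Finset.sum_comp (fun u : ℕ => Real.exp (-((u - m : ℕ) : ℝ) / a)) Int.natAbs]
  refine le_trans (Finset.sum_le_sum (g := fun u : ℕ => 2 * Real.exp (-((u - m : ℕ) : ℝ) / a))
    fun u _ => ?_) ?_
  · rw [nsmul_eq_mul]
    refine mul_le_mul_of_nonneg_right ?_ (Real.exp_pos _).le
    have hsub : T.filter (fun z => z.natAbs = u) ⊆ {(u : ℤ), -(u : ℤ)} := by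
      intro z hz
      have := (Finset.mem_filter.1 hz).2
      simp only [Finset.mem_insert, Finset.mem_singleton]
      omega
    exact_mod_cast (Finset.card_le_card hsub).trans Finset.card_le_two
  · rw [← Finset.mul_sum]
    exact mul_le_mul_of_nonneg_left (sum_exp_neg_nat_sub_le _ m ha) (by norm_num)

/-- The distance dominates each coordinate difference, hence their mean; so the exponential is at
most a product over coordinates with decay length `a * d`. Least-absolute-value representatives
embed the lattice, periodic or not, into `ℤ^d`, where the sum factorizes. -/
theorem sum_exp_neg_siteDist_sub_le {d : ℕ} (hd : 1 ≤ d) {L : Fin d → ℕ} (Λ : Finset (Site L))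
    (x : Site L) (m : ℕ) {a : ℝ} (ha : 0 < a) :
    ∑ y ∈ Λ, Real.exp (-((siteDist x y - m : ℕ) : ℝ) / a) ≤ (2 * (m + 1 + a * d)) ^ d := by
  classical
  have hd' : (0 : ℝ) < d := Nat.cast_pos.2 hd
  have had : 0 < a * d := by positivity
  set f : ℤ → ℝ := fun z => Real.exp (-((z.natAbs - m : ℕ) : ℝ) / (a * d)) with hf
  set φ : Site L → Fin d → ℤ := fun y k => (x k - y k).valMinAbs with hφ
  have hφinj : Function.Injective φ := by
    intro y y' h
    funext k
    have := congrFun h k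
    simp only [hφ, ZMod.valMinAbs_inj] at this
    exact sub_right_injective this
  have hterm : ∀ y, Real.exp (-((siteDist x y - m : ℕ) : ℝ) / a) ≤ ∏ k, f (φ y k) := by
    intro y
    rw [hf, ← Real.exp_sum, ← Finset.sum_div, Finset.sum_neg_distrib]
    refine Real.exp_le_exp.2 ?_
    rw [neg_div, neg_div, neg_le_neg_iff, div_le_div_iff₀ had ha]
    have h1 : ∀ k, ((φ y k).natAbs - m : ℕ) ≤ siteDist x y - m := fun k =>
      Nat.sub_le_sub_right (Finset.single_le_sum (f := fun k => (φ y k).natAbs)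
        (fun _ _ => Nat.zero_le _) (Finset.mem_univ k)) m
    have h2 : ∑ k, (((φ y k).natAbs - m : ℕ) : ℝ) ≤ d * ((siteDist x y - m : ℕ) : ℝ) := by
      refine (Finset.sum_le_card_nsmul Finset.univ _ ((siteDist x y - m : ℕ) : ℝ)
        fun k _ => by exact_mod_cast h1 k).trans_eq ?_
      simp
    nlinarith
  refine (Finset.sum_le_sum fun y _ => hterm y).trans ?_
  rw [← Finset.sum_image (f := fun z : Fin d → ℤ => ∏ k, f (z k)) (hφinj.injOn)]
  have hsub : Λ.image φ ⊆ Fintype.piFinset fun k => Λ.image fun y => φ y k := by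
    intro z hz
    obtain ⟨y, hy, rfl⟩ := Finset.mem_image.1 hz
    exact Fintype.mem_piFinset.2 fun k => Finset.mem_image_of_mem (fun y => φ y k) hy
  refine (Finset.sum_le_sum_of_subset_of_nonneg hsub fun z _ _ =>
    Finset.prod_nonneg fun k _ => (Real.exp_pos _).le).trans ?_
  rw [← Finset.prod_univ_sum (fun k => Λ.image fun y => φ y k) (fun _ z => f z)]
  refine (Finset.prod_le_prod (fun k _ => Finset.sum_nonneg fun z _ => (Real.exp_pos _).le)
    fun k _ => sum_exp_neg_natAbs_sub_le _ m had).trans_eq (by simp)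

/-- A sum over tuples, all of whose entries outside `S` are coupled to the entries in `S`. -/
theorem sum_tuples_prod_le {κ V : Type*} [Fintype κ] [DecidableEq κ] [Fintype V]
    (S : Finset κ) (G : V → V → ℝ) (hG : ∀ x y, 0 ≤ G x y) {B : ℝ}
    (hB : ∀ x, ∑ y, G x y ≤ B) :
    ∑ t : κ → V, ∏ k ∈ Sᶜ, ∑ j ∈ S, G (t j) (t k) ≤
      (Fintype.card V : ℝ) ^ S.card * (S.card * B) ^ (Sᶜ).card := by
  classical
  have h1 : ∀ t : κ → V, ∏ k ∈ Sᶜ, ∑ j ∈ S, G (t j) (t k) =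
      (fun q : ({k // k ∈ S} → V) × ({k // k ∉ S} → V) =>
        ∏ k, ∑ j, G (q.1 j) (q.2 k)) (Equiv.piEquivPiSubtypeProd (· ∈ S) (fun _ => V) t) := by
    intro t
    rw [Finset.prod_subtype (p := (· ∉ S)) Sᶜ (fun k => Finset.mem_compl)]
    refine Finset.prod_congr rfl fun k _ => ?_
    rw [Finset.sum_subtype (p := (· ∈ S)) S (fun k => Iff.rfl)]
    rfl
  rw [Finset.sum_congr rfl fun t _ => h1 t]
  refine le_of_eq_of_le (Equiv.sum_comp (Equiv.piEquivPiSubtypeProd (· ∈ S) fun _ => V)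
    (fun q => ∏ k, ∑ j, G (q.1 j) (q.2 k))) ?_
  rw [Fintype.sum_prod_type]
  -- Once the entries in `S` are fixed, the remaining ones are independent and the sum of products
  -- is a product of sums.
  have h2 : ∀ a : {k // k ∈ S} → V, ∑ b : {k // k ∉ S} → V, ∏ k, ∑ j, G (a j) (b k) ≤
      (S.card * B) ^ (Sᶜ).card := by
    intro a
    have := Finset.prod_univ_sum (fun _ : {k // k ∉ S} => (Finset.univ : Finset V))
      (fun _ y => ∑ j, G (a j) y)
    rw [Fintype.piFinset_univ] at this
    rw [← this, Finset.prod_const]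
    have hc : (Finset.univ : Finset {k // k ∉ S}).card = (Sᶜ).card := by
      rw [Finset.card_univ, Fintype.card_subtype_compl, Finset.card_compl, Fintype.card_coe]
    rw [hc]
    refine pow_le_pow_left₀ (Finset.sum_nonneg fun _ _ => Finset.sum_nonneg fun _ _ => hG _ _) ?_ _
    rw [Finset.sum_comm]
    refine (Finset.sum_le_card_nsmul _ _ B fun j _ => hB (a j)).trans_eq ?_
    simp
  refine (Finset.sum_le_card_nsmul _ _ _ fun a _ => h2 a).trans_eq ?_
  simp

end Combinatorics

/-- The factor pulled to the front leaves a `1` behind, so the remaining product is still indexed by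
`Fin N`. -/
theorem list_prod_ofFn_eq_mul_update {M : Type*} [Monoid M] {N : ℕ} (f : Fin N → M) (k : Fin N)
    (h : ∀ j, j ≠ k → Commute (f k) (f j)) :
    (List.ofFn f).prod = f k * (List.ofFn (Function.update f k 1)).prod := by
  induction N with
  | zero => exact k.elim0
  | succ N ih =>
    rw [List.ofFn_succ, List.ofFn_succ, List.prod_cons, List.prod_cons]
    refine Fin.cases (fun h => ?_) (fun k h => ?_) k h
    · have : (fun i : Fin N => Function.update f 0 1 i.succ) = fun i => f i.succ := by
        funext i; simp
      rw [this, Function.update_self, one_mul]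
    · have hu : (fun i : Fin N => Function.update f k.succ 1 i.succ) =
          Function.update (fun i => f i.succ) k 1 := by
        funext i
        by_cases hi : i = k
        · subst hi; simp
        · rw [Function.update_of_ne hi,
            Function.update_of_ne fun h => hi (Fin.succ_injective _ h)]
      rw [hu, Function.update_of_ne (Fin.succ_ne_zero k).symm,
        ih (fun i => f i.succ) k fun j hj => h _ fun h => hj (Fin.succ_injective _ h),
        ← mul_assoc, ← mul_assoc, (h 0 (Fin.succ_ne_zero k).symm).eq]

theorem norm_list_prod_ofFn_le {R : Type*} [SeminormedRing R] (h1 : ‖(1 : R)‖ ≤ 1) {N : ℕ}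
    (f : Fin N → R) {c : ℝ} (hf : ∀ k, ‖f k‖ ≤ c) : ‖(List.ofFn f).prod‖ ≤ c ^ N := by
  induction N with
  | zero => simpa using h1
  | succ N ih =>
    rw [List.ofFn_succ, List.prod_cons, pow_succ']
    exact (norm_mul_le _ _).trans (mul_le_mul (hf 0) (ih _ fun k => hf _) (norm_nonneg _)
      ((norm_nonneg _).trans (hf 0)))

/-! ### Moments of local sums in a clustering state. -/

section Moments

variable {d : ℕ} {L : Fin d → ℕ} {Λ : Finset (Site L)}

theorem norm_one_op_le : ‖(1 : Op Λ)‖ ≤ 1 := by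
  rw [← Matrix.diagonal_one, Matrix.l2_opNorm_diagonal]
  exact (pi_norm_le_iff_of_nonneg zero_le_one).2 fun _ => by simp

/-- A product of centred local observables, one of which is far from the others. -/
theorem IsClustering.norm_avg_prod_le_of_isolated {ρ : Op Λ} {r : ℕ} {ξ : ℝ}
    (hcl : IsClustering r ξ ρ) (hξ : 0 < ξ) {a : Λ → Op Λ} {s : ℕ}
    (hsupp : ∀ i, IsSupportedOn (a i) {j | siteDist i.1 j.1 ≤ s}) (hnorm : ∀ i, ‖a i‖ ≤ 2)
    (hmean : ∀ i, avg ρ (a i) = 0) {N : ℕ} (hN : 2 ≤ N) (t : Fin N → Λ) (k : Fin N) {D : ℕ}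
    (hD : 2 * s + r + 1 ≤ D) (hk : ∀ j, j ≠ k → D ≤ siteDist (t k).1 (t j).1) :
    ‖avg ρ (List.ofFn fun j => a (t j)).prod‖ ≤
      2 * 2 ^ N * Real.exp (-((D - 2 * s : ℕ) : ℝ) / ξ) := by
  set X : Set Λ := {j | siteDist (t k).1 j.1 ≤ s} with hX
  set Y : Set Λ := {i | ∃ j, j ≠ k ∧ siteDist (t j).1 i.1 ≤ s} with hY
  have hdist : ∀ i ∈ X, ∀ i' ∈ Y, D - 2 * s ≤ siteDist i.1 i'.1 := by
    rintro i hi i' ⟨j, hj, hij⟩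
    have h1 := hk j hj
    have h2 := siteDist_triangle (t k).1 i.1 (t j).1
    have h3 := siteDist_triangle i.1 i'.1 (t j).1
    rw [siteDist_comm i'.1] at h3
    simp only [hX, Set.mem_ofPred_eq] at hi
    omega
  have hXne : X.Nonempty := ⟨t k, by simp [hX, siteDist_self]⟩
  obtain ⟨j₀, hj₀⟩ : ∃ j, j ≠ k := by
    have : Nontrivial (Fin N) := Fin.nontrivial_iff_two_le.2 hN
    exact exists_ne k
  have hYne : Y.Nonempty := ⟨t j₀, j₀, hj₀, by rw [siteDist_self]; exact Nat.zero_le _⟩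
  -- Each of the two supports extends by `s`. The remaining distance is at least `r + 1`: `r` makes
  -- clustering applicable, and the extra `1` makes the supports disjoint, so that the isolated
  -- factor commutes.
  have hset : D - 2 * s ≤ setDist X Y := le_setDist hXne hYne hdist
  have hdisj : Disjoint X Y := by
    rw [Set.disjoint_left]
    intro i hi hi'
    have := hdist i hi i hi'
    rw [siteDist_self] at this
    omega
  have hsY : ∀ j, j ≠ k → IsSupportedOn (a (t j)) Y := fun j hj =>
    (hsupp (t j)).mono fun i hi => ⟨j, hj, hi⟩
  rw [list_prod_ofFn_eq_mul_update (fun j => a (t j)) k fun j hj =>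
    (hsupp (t k)).commute (hsY j hj) hdisj]
  set B := (List.ofFn (Function.update (fun j => a (t j)) k 1)).prod with hB
  have hBs : IsSupportedOn B Y := by
    refine isSupportedOn_list_prod fun A hA => ?_
    obtain ⟨j, rfl⟩ := (List.mem_ofFn' _ _).1 hA
    by_cases hj : j = k
    · subst hj
      rw [Function.update_self]
      exact isSupportedOn_one Y
    · rw [Function.update_of_ne hj]
      exact hsY j hj
  have hBn : ‖B‖ ≤ 2 ^ N := by
    refine norm_list_prod_ofFn_le norm_one_op_le _ fun j => ?_
    by_cases hj : j = k
    · subst hj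
      rw [Function.update_self]
      exact norm_one_op_le.trans one_le_two
    · rw [Function.update_of_ne hj]
      exact hnorm _
  have h := hcl X Y hXne hYne (by omega) (a (t k)) B (hsupp (t k)) hBs
  rw [hmean, zero_mul, sub_zero] at h
  refine h.trans (mul_le_mul (mul_le_mul (hnorm _) hBn (norm_nonneg _) zero_le_two) ?_
    (Real.exp_pos _).le (by positivity))
  refine Real.exp_le_exp.2 (div_le_div_of_nonneg_right (neg_le_neg ?_) hξ.le)
  exact_mod_cast hset

/-- Clustering bounds a correlation by a sum over the ways to attach half of the observables to
the other half. -/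
theorem IsClustering.norm_avg_prod_le {ρ : Op Λ} {r : ℕ} {ξ : ℝ}
    (hcl : IsClustering r ξ ρ) (hξ : 0 < ξ) (hρ : ∀ A, ‖avg ρ A‖ ≤ ‖A‖)
    {a : Λ → Op Λ} {s : ℕ}
    (hsupp : ∀ i, IsSupportedOn (a i) {j | siteDist i.1 j.1 ≤ s}) (hnorm : ∀ i, ‖a i‖ ≤ 2)
    (hmean : ∀ i, avg ρ (a i) = 0) {p : ℕ} (hp : 1 ≤ p) (t : Fin (2 * p) → Λ) :
    ∃ S : Finset (Fin (2 * p)), S.card = p ∧ ‖avg ρ (List.ofFn fun j => a (t j)).prod‖ ≤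
      2 * 2 ^ (2 * p) * ∏ k ∈ Sᶜ, ∑ j ∈ S,
        Real.exp (-((siteDist (t j).1 (t k).1 - (2 * s + r + 1) : ℕ) : ℝ) / (ξ * p)) := by
  classical
  set m := 2 * s + r + 1 with hm
  have hp' : (0 : ℝ) < p := Nat.cast_pos.2 hp
  have : Nontrivial (Fin (2 * p)) := Fin.nontrivial_iff_two_le.2 (by omega)
  have hex : ∃ D : ℕ, ∀ k, ∃ j, j ≠ k ∧ siteDist (t k).1 (t j).1 ≤ D := by
    choose g hg using fun k : Fin (2 * p) => exists_ne k
    exact ⟨Finset.univ.sup fun k => siteDist (t k).1 (t (g k)).1, fun k => ⟨g k, hg k,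
      Finset.le_sup (f := fun k => siteDist (t k).1 (t (g k)).1) (Finset.mem_univ k)⟩⟩
  -- The least distance at which no index is isolated. It provides a dominating half, and its
  -- minimality provides an index that is far from all others.
  set D := Nat.find hex with hDdef
  have hD := Nat.find_spec hex
  obtain ⟨S, hS, hdom⟩ := exists_dominating_card_eq
    (R := fun k j => siteDist (t k).1 (t j).1 ≤ D)
    (fun k j h => by rwa [siteDist_comm]) hD (p := p) (by simp)
  refine ⟨S, hS, ?_⟩
  -- The decay is split evenly over the `p` indices outside `S`, which is why the decay length
  -- becomes `ξ * p`.
  have hlow : Real.exp (-((D - m : ℕ) : ℝ) / ξ) ≤ ∏ k ∈ Sᶜ, ∑ j ∈ S,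
      Real.exp (-((siteDist (t j).1 (t k).1 - m : ℕ) : ℝ) / (ξ * p)) := by
    have hone : ∀ k ∈ Sᶜ, Real.exp (-((D - m : ℕ) : ℝ) / (ξ * p)) ≤ ∑ j ∈ S,
        Real.exp (-((siteDist (t j).1 (t k).1 - m : ℕ) : ℝ) / (ξ * p)) := by
      intro k hk
      obtain ⟨j, hj, hjk⟩ := hdom k (Finset.mem_compl.1 hk)
      rw [siteDist_comm] at hjk
      refine le_trans ?_ (Finset.single_le_sum (fun _ _ => (Real.exp_pos _).le) hj)
      refine Real.exp_le_exp.2 (div_le_div_of_nonneg_right (neg_le_neg ?_) (by positivity))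
      exact_mod_cast Nat.sub_le_sub_right hjk m
    refine le_trans (le_of_eq ?_) (Finset.prod_le_prod (fun _ _ => (Real.exp_pos _).le) hone)
    rw [Finset.prod_const, Finset.card_compl, hS, Fintype.card_fin, ← Real.exp_nat_mul]
    congr 1
    rw [show 2 * p - p = p by omega]
    field_simp
  refine le_trans ?_ (mul_le_mul_of_nonneg_left hlow (by positivity))
  -- Below the threshold `m` the truncated exponent is zero and the norm bound is enough. Otherwise
  -- `D ≥ m ≥ 1`, and the failure of `D - 1` exhibits an index at distance at least `D` from the
  -- rest.
  rcases Nat.lt_or_ge D m with hDm | hDm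
  · rw [Nat.sub_eq_zero_of_le hDm.le, Nat.cast_zero, neg_zero, zero_div, Real.exp_zero, mul_one]
    refine ((hρ _).trans (norm_list_prod_ofFn_le norm_one_op_le _ fun k => hnorm _)).trans ?_
    linarith [pow_pos (two_pos : (0 : ℝ) < 2) (2 * p)]
  · have hpos : D - 1 < D := by omega
    have hmin := Nat.find_min hex hpos
    push Not at hmin
    obtain ⟨k, hk⟩ := hmin
    refine (hcl.norm_avg_prod_le_of_isolated hξ hsupp hnorm hmean (by omega) t k hDm
      fun j hj => by have := hk j hj; omega).trans ?_
    refine mul_le_mul_of_nonneg_left (Real.exp_le_exp.2 (div_le_div_of_nonneg_right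
      (neg_le_neg ?_) hξ.le)) (by positivity)
    have : D - m ≤ D - 2 * s := by omega
    exact_mod_cast this

/-- The dominating half depends on the tuple, so the sum runs over all halves, at most `4^p` of
them. For each half, `p` sites are free and every other site contributes at most `p` lattice sums.
The prefactors combine through `2 * 4^p * 4^p ≤ 32^p`. -/
theorem IsClustering.norm_avg_sum_pow_le {ρ : Op Λ} {r : ℕ} {ξ : ℝ} (hd : 1 ≤ d)
    (hcl : IsClustering r ξ ρ) (hξ : 0 < ξ) (hρ : ∀ A, ‖avg ρ A‖ ≤ ‖A‖)
    {a : Λ → Op Λ} {s : ℕ}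
    (hsupp : ∀ i, IsSupportedOn (a i) {j | siteDist i.1 j.1 ≤ s}) (hnorm : ∀ i, ‖a i‖ ≤ 2)
    (hmean : ∀ i, avg ρ (a i) = 0) {p : ℕ} (hp : 1 ≤ p) :
    ‖avg ρ ((∑ i, a i) ^ (2 * p))‖ ≤
      (32 * Λ.card * p * (2 * ((2 * s + r + 1 : ℕ) + 1 + ξ * p * d)) ^ d) ^ p := by
  classical
  set m := 2 * s + r + 1 with hm
  set b : ℝ := (2 * ((m : ℕ) + 1 + ξ * p * d)) ^ d with hb
  have hp' : (0 : ℝ) < p := Nat.cast_pos.2 hp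
  have hexp : (∑ i, a i) ^ (2 * p) =
      ∑ t : Fin (2 * p) → Λ, (List.ofFn fun j => a (t j)).prod := by
    have := (MultilinearMap.mkPiAlgebraFin ℂ (2 * p) (Op Λ)).map_sum
      (fun (_ : Fin (2 * p)) (j : Λ) => a j)
    simpa using this
  set F : (Fin (2 * p) → Λ) → Finset (Fin (2 * p)) → ℝ := fun t S => ∏ k ∈ Sᶜ, ∑ j ∈ S,
        Real.exp (-((siteDist (t j).1 (t k).1 - m : ℕ) : ℝ) / (ξ * p)) with hF
  have hF0 : ∀ t S, 0 ≤ F t S := fun t S =>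
    Finset.prod_nonneg fun _ _ => Finset.sum_nonneg fun _ _ => (Real.exp_pos _).le
  have hterm : ∀ t : Fin (2 * p) → Λ, ‖avg ρ (List.ofFn fun j => a (t j)).prod‖ ≤
      2 * 2 ^ (2 * p) * ∑ S ∈ Finset.univ.powersetCard p, F t S := by
    intro t
    obtain ⟨S, hS, h⟩ := hcl.norm_avg_prod_le hξ hρ hsupp hnorm hmean hp t
    refine h.trans (mul_le_mul_of_nonneg_left ?_ (by positivity))
    exact Finset.single_le_sum (f := F t) (fun S _ => hF0 t S)
      (Finset.mem_powersetCard.2 ⟨Finset.subset_univ _, hS⟩)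
  have hsum : ∀ S ∈ (Finset.univ : Finset (Fin (2 * p))).powersetCard p,
      ∑ t : Fin (2 * p) → Λ, F t S ≤ (Λ.card * (p * b)) ^ p := by
    intro S hS
    have hS' := (Finset.mem_powersetCard.1 hS).2
    have h := sum_tuples_prod_le S
      (fun x y : Λ => Real.exp (-((siteDist x.1 y.1 - m : ℕ) : ℝ) / (ξ * p)))
      (fun _ _ => (Real.exp_pos _).le) (B := b) fun x => by
        rw [Finset.univ_eq_attach, Finset.sum_attach Λ
          (fun y => Real.exp (-((siteDist x.1 y - m : ℕ) : ℝ) / (ξ * p)))]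
        exact sum_exp_neg_siteDist_sub_le hd Λ x.1 m (by positivity)
    rw [Finset.card_compl, hS', Fintype.card_fin, Fintype.card_coe, show 2 * p - p = p by omega,
      ← mul_pow] at h
    exact h
  have hchoose : ((2 * p).choose p : ℝ) ≤ 2 ^ (2 * p) := by
    exact_mod_cast Nat.choose_le_two_pow _ _
  have h2 : (2 : ℝ) ≤ 2 ^ p := by
    simpa using pow_le_pow_right₀ (one_le_two : (1 : ℝ) ≤ 2) hp
  have hb0 : 0 ≤ b := by positivity
  calc ‖avg ρ ((∑ i, a i) ^ (2 * p))‖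
      ≤ ∑ t : Fin (2 * p) → Λ, 2 * 2 ^ (2 * p) * ∑ S ∈ Finset.univ.powersetCard p, F t S := by
        rw [hexp, avg_sum]
        exact norm_sum_le_of_le _ fun t _ => hterm t
    _ = 2 * 2 ^ (2 * p) * ∑ S ∈ Finset.univ.powersetCard p, ∑ t : Fin (2 * p) → Λ, F t S := by
        rw [← Finset.mul_sum, Finset.sum_comm]
    _ ≤ 2 * 2 ^ (2 * p) * ((2 * p).choose p * (Λ.card * (p * b)) ^ p) := by
        refine mul_le_mul_of_nonneg_left ?_ (by positivity)
        refine (Finset.sum_le_card_nsmul _ _ _ hsum).trans_eq ?_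
        rw [Finset.card_powersetCard, Finset.card_univ, Fintype.card_fin, nsmul_eq_mul]
    _ ≤ 2 ^ p * 2 ^ (2 * p) * (2 ^ (2 * p) * (Λ.card * (p * b)) ^ p) := by gcongr
    _ = (32 * Λ.card * p * b) ^ p := by
        rw [pow_mul, ← mul_pow, ← mul_pow, ← mul_pow]
        congr 1
        ring

/-- Moments of a sum of local observables in a clustering canonical state. -/
theorem IsClustering.norm_avg_canonicalState_pow_le {H : Op Λ} (hH : H.IsHermitian) {β : ℝ}
    {r : ℕ} {ξ : ℝ} (hd : 1 ≤ d) (hcl : IsClustering r ξ (canonicalState H β)) (hξ : 0 < ξ)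
    {a : Λ → Op Λ} {s : ℕ} (ha : IsLocalFamily a s) {p : ℕ} (hp : 1 ≤ p) :
    ‖avg (canonicalState H β)
        ((∑ i, a i - avg (canonicalState H β) (∑ i, a i) • 1) ^ (2 * p))‖ ≤
      (32 * Λ.card * p * (2 * ((2 * s + r + 1 : ℕ) + 1 + ξ * p * d)) ^ d) ^ p := by
  have hρ := norm_avg_canonicalState_le hH β
  have h := hcl.norm_avg_sum_pow_le hd hξ hρ
    (a := fun i => a i - avg (canonicalState H β) (a i) • 1) (s := s)
    (fun i => (ha.supported i).sub (isSupportedOn_smul_one _ _)) (fun i => ?_) (fun i => ?_) hp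
  · rwa [Finset.sum_sub_distrib, ← Finset.sum_smul, ← avg_sum] at h
  · refine (norm_sub_le _ _).trans ?_
    rw [norm_smul]
    have h1 := (hρ (a i)).trans (ha.norm_le i)
    have h2 := mul_le_mul h1 (norm_one_op_le (Λ := Λ)) (norm_nonneg _) zero_le_one
    linarith [ha.norm_le i]
  · rw [avg_sub, avg_smul, avg_canonicalState_one hH, mul_one, sub_self]

end Moments

/-! ### Boltzmann weight of the maximizing shell against the partition function. -/

section Shells

variable {d : ℕ} {L : Fin d → ℕ} {Λ : Finset (Site L)} {H : Op Λ}

theorem card_mul_exp_le_of_subset_shell {hH : H.IsHermitian} {β E Δ : ℝ}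
    (hmax : IsShellMaximizer hH β E Δ) {T : Finset (Config Λ)} {E' : ℝ}
    (hT : T ⊆ shell hH E' Δ) :
    T.card * Real.exp (-β * E') ≤ Real.exp (-β * E) * shellCount hH E Δ := by
  refine le_trans ?_ (hmax E')
  rw [mul_comm]
  exact mul_le_mul_of_nonneg_left (Nat.cast_le.2 (Finset.card_le_card hT)) (Real.exp_pos _).le

/-- With the states of `T` ordered by energy, the first `j` of them fit into the shell ending at the
`j`-th level, so by maximality the `j`-th Boltzmann weight is at most `M/j`, where `M` is the weight
on the right. The induction adds the top level each time. -/
theorem sum_exp_le_mul_harmonic {hH : H.IsHermitian} {β E Δ : ℝ}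
    (hmax : IsShellMaximizer hH β E Δ) (T : Finset (Config Λ))
    (hT : ∀ m ∈ T, ∀ m' ∈ T, hH.eigenvalues m' - Δ < hH.eigenvalues m) :
    ∑ m ∈ T, Real.exp (-β * hH.eigenvalues m) ≤
      Real.exp (-β * E) * shellCount hH E Δ * (harmonic T.card : ℝ) := by
  induction T using Finset.induction_on_max_value hH.eigenvalues with
  | empty => simp
  | insert m T hm hmT ih =>
    have hsub : insert m T ⊆ shell hH (hH.eigenvalues m) Δ := by
      intro m' hm'
      simp only [shell, Finset.mem_filter, Finset.mem_univ, true_and, Set.mem_Ioc]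
      refine ⟨hT _ hm' _ (Finset.mem_insert_self m T), ?_⟩
      rcases Finset.mem_insert.1 hm' with rfl | h
      · exact le_rfl
      · exact hmT _ h
    have h1 := card_mul_exp_le_of_subset_shell hmax hsub
    have h2 := ih fun m₁ h₁ m₂ h₂ =>
      hT _ (Finset.mem_insert_of_mem h₁) _ (Finset.mem_insert_of_mem h₂)
    rw [Finset.card_insert_of_notMem hm] at h1 ⊢
    rw [Finset.sum_insert hm, harmonic_succ, Rat.cast_add, mul_add, add_comm]
    refine add_le_add h2 ?_
    have hc : (0 : ℝ) < ((T.card + 1 : ℕ) : ℝ) := by positivity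
    rw [Rat.cast_inv, Rat.cast_natCast, ← div_eq_mul_inv, le_div_iff₀ hc]
    linarith

/-- There are at most `2^n` states, so the harmonic number is at most `1 + n log 2`. This bound
needs no control of `β * Δ`. -/
theorem sum_exp_le_mul_card {hH : H.IsHermitian} {β E Δ : ℝ}
    (hmax : IsShellMaximizer hH β E Δ) (T : Finset (Config Λ))
    (hT : ∀ m ∈ T, ∀ m' ∈ T, hH.eigenvalues m' - Δ < hH.eigenvalues m) :
    ∑ m ∈ T, Real.exp (-β * hH.eigenvalues m) ≤
      Real.exp (-β * E) * shellCount hH E Δ * (1 + Λ.card) := by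
  refine (sum_exp_le_mul_harmonic hmax T hT).trans (mul_le_mul_of_nonneg_left ?_
    (by positivity))
  refine (harmonic_le_one_add_log _).trans ?_
  have hcard : T.card ≤ 2 ^ Λ.card := by
    refine (Finset.card_le_univ T).trans_eq ?_
    simp
  have h1 : Real.log T.card ≤ Real.log ((2 : ℝ) ^ Λ.card) := by
    rcases Nat.eq_zero_or_pos T.card with h | h
    · rw [h, Nat.cast_zero, Real.log_zero]
      exact Real.log_nonneg (one_le_pow₀ one_le_two)
    · exact Real.log_le_log (Nat.cast_pos.2 h) (by exact_mod_cast hcard)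
  rw [Real.log_pow] at h1
  nlinarith [Real.log_two_lt_d9, (Nat.cast_nonneg Λ.card : (0 : ℝ) ≤ Λ.card)]

/-- Within a window of width `Δ` no weight exceeds that of the top level by more than `exp(β * Δ)`.
-/
theorem sum_exp_le_mul_exp {hH : H.IsHermitian} {β E Δ : ℝ} (hβ : 0 ≤ β)
    (hmax : IsShellMaximizer hH β E Δ) (T : Finset (Config Λ))
    (hT : ∀ m ∈ T, ∀ m' ∈ T, hH.eigenvalues m' - Δ < hH.eigenvalues m) :
    ∑ m ∈ T, Real.exp (-β * hH.eigenvalues m) ≤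
      Real.exp (-β * E) * shellCount hH E Δ * Real.exp (β * Δ) := by
  rcases T.eq_empty_or_nonempty with rfl | hne
  · rw [Finset.sum_empty]
    positivity
  · obtain ⟨m, hm, hmT⟩ := Finset.exists_max_image T hH.eigenvalues hne
    have hsub : T ⊆ shell hH (hH.eigenvalues m) Δ := by
      intro m' hm'
      simp only [shell, Finset.mem_filter, Finset.mem_univ, true_and, Set.mem_Ioc]
      exact ⟨hT _ hm' _ hm, hmT _ hm'⟩
    have h1 := card_mul_exp_le_of_subset_shell hmax hsub
    refine (Finset.sum_le_card_nsmul T _ (Real.exp (-β * hH.eigenvalues m) * Real.exp (β * Δ))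
      fun m' hm' => ?_).trans ?_
    · rw [← Real.exp_add]
      refine Real.exp_le_exp.2 ?_
      nlinarith [hT _ hm' _ hm]
    · rw [nsmul_eq_mul, ← mul_assoc]
      exact mul_le_mul_of_nonneg_right h1 (Real.exp_pos _).le

theorem avg_canonicalState_sub_sq_re (hH : H.IsHermitian) (β c : ℝ) :
    (avg (canonicalState H β) ((H - (c : ℂ) • 1) ^ 2)).re =
      ∑ m, Real.exp (-β * hH.eigenvalues m) / partitionFunction hH β *
        (hH.eigenvalues m - c) ^ 2 := by
  rw [avg_canonicalState_re hH]
  simp only [eigenMean_sub_smul_one_sq, Complex.ofReal_re]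

/-- If shells of width `Δ` carry at most `M`, then the partition function is at most `M` times the
number of shells needed to cover the energy fluctuations. -/
theorem partitionFunction_le_of_variance_le (hH : H.IsHermitian) {β c V Δ M : ℝ} (hΔ : 0 < Δ)
    (hV : 0 < V) (hM : ∀ T : Finset (Config Λ),
      (∀ m ∈ T, ∀ m' ∈ T, hH.eigenvalues m' - Δ < hH.eigenvalues m) →
      ∑ m ∈ T, Real.exp (-β * hH.eigenvalues m) ≤ M)
    (hvar : (avg (canonicalState H β) ((H - (c : ℂ) • 1) ^ 2)).re ≤ V) :
    partitionFunction hH β ≤ 2 * (2 * Real.sqrt (2 * V) / Δ + 1) * M := by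
  classical
  -- Chebyshev at this radius leaves at most half of the partition function outside, hence the
  -- factor 2 in the conclusion.
  set s := Real.sqrt (2 * V) with hs
  have hs2 : s ^ 2 = 2 * V := Real.sq_sqrt (by positivity)
  have hs0 : 0 ≤ s := Real.sqrt_nonneg _
  have hZ := partitionFunction_pos hH β
  have hM0 : 0 ≤ M := by simpa using hM ∅ (by simp)
  set P : Config Λ → Prop := fun m => |hH.eigenvalues m - c| ≤ s with hP
  have htail : ∑ m with ¬ P m, Real.exp (-β * hH.eigenvalues m) ≤
      partitionFunction hH β / 2 := by
    rw [avg_canonicalState_sub_sq_re hH] at hvar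
    have h1 : ∑ m with ¬ P m, Real.exp (-β * hH.eigenvalues m) * (2 * V) ≤
        partitionFunction hH β * V := by
      calc ∑ m with ¬ P m, Real.exp (-β * hH.eigenvalues m) * (2 * V)
          ≤ ∑ m with ¬ P m, Real.exp (-β * hH.eigenvalues m) * (hH.eigenvalues m - c) ^ 2 := by
            refine Finset.sum_le_sum fun m hm => ?_
            refine mul_le_mul_of_nonneg_left ?_ (Real.exp_pos _).le
            have : s < |hH.eigenvalues m - c| := not_le.1 (Finset.mem_filter.1 hm).2
            rw [← hs2, ← sq_abs (hH.eigenvalues m - c)]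
            exact pow_le_pow_left₀ hs0 this.le 2
        _ ≤ ∑ m, Real.exp (-β * hH.eigenvalues m) * (hH.eigenvalues m - c) ^ 2 :=
            Finset.sum_le_sum_of_subset_of_nonneg (Finset.filter_subset _ _)
              fun _ _ _ => by positivity
        _ = partitionFunction hH β * ∑ m, Real.exp (-β * hH.eigenvalues m) /
              partitionFunction hH β * (hH.eigenvalues m - c) ^ 2 := by
            rw [Finset.mul_sum]
            refine Finset.sum_congr rfl fun m _ => ?_
            field_simp
        _ ≤ partitionFunction hH β * V := mul_le_mul_of_nonneg_left hvar hZ.le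
    rw [← Finset.sum_mul] at h1
    rw [le_div_iff₀ two_pos]
    refine le_of_mul_le_mul_right ?_ hV
    linarith
  have hbulk : ∑ m with P m, Real.exp (-β * hH.eigenvalues m) ≤ (2 * s / Δ + 1) * M := by
    -- The bulk is cut into half-open windows of width `Δ`, so two levels with the same index differ
    -- by strictly less than `Δ`.
    set g : Config Λ → ℕ := fun m => ⌊(hH.eigenvalues m - c + s) / Δ⌋₊ with hg
    have hmaps : ∀ m ∈ Finset.univ.filter P, g m ∈ Finset.range (⌊2 * s / Δ⌋₊ + 1) := by
      intro m hm
      rw [Finset.mem_range, Nat.lt_succ_iff]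
      refine Nat.floor_le_floor (div_le_div_of_nonneg_right ?_ hΔ.le)
      linarith [(abs_le.1 (Finset.mem_filter.1 hm).2).2]
    rw [← Finset.sum_fiberwise_of_maps_to hmaps]
    refine (Finset.sum_le_card_nsmul _ _ M fun j _ => hM _ fun m hm m' hm' => ?_).trans ?_
    · have key : ∀ m ∈ (Finset.univ.filter P).filter (fun m => g m = j),
          j * Δ ≤ hH.eigenvalues m - c + s ∧ hH.eigenvalues m - c + s < (j + 1) * Δ := by
        intro m hm
        obtain ⟨h1, h2⟩ := Finset.mem_filter.1 hm
        have h3 := (abs_le.1 (Finset.mem_filter.1 h1).2).1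
        have h4 : 0 ≤ (hH.eigenvalues m - c + s) / Δ := div_nonneg (by linarith) hΔ.le
        rw [← h2]
        exact ⟨(le_div_iff₀ hΔ).1 (Nat.floor_le h4), (div_lt_iff₀ hΔ).1 (Nat.lt_floor_add_one _)⟩
      have h1 := (key m hm).1
      have h2 := (key m' hm').2
      linarith
    · rw [Finset.card_range, nsmul_eq_mul]
      refine mul_le_mul_of_nonneg_right ?_ hM0
      push_cast
      have := Nat.floor_le (a := 2 * s / Δ) (by positivity)
      linarith
  have hsplit := Finset.sum_filter_add_sum_filter_not Finset.univ P
    (fun m => Real.exp (-β * hH.eigenvalues m))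
  have : partitionFunction hH β = ∑ m, Real.exp (-β * hH.eigenvalues m) := rfl
  linarith

/-- The Boltzmann weight of the maximizing energy shell is not much smaller than the partition
function. -/
theorem partitionFunction_le_of_isClustering {h : Λ → Op Λ} {ℓ₀ r : ℕ} {ξ δ β E Δ : ℝ}
    (hd : 1 ≤ d) (hh : IsLocalFamily h ℓ₀) (hξ : 0 < ξ) (hδ : 0 < δ)
    (hw : AdmissibleWidth δ Λ.card β Δ) (hmax : IsShellMaximizer hh.isHermitian_sum β E Δ)
    (hcl : IsClustering r ξ (canonicalState (∑ i, h i) β)) :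
    partitionFunction hh.isHermitian_sum β ≤
      4 * Real.exp (1 / δ) *
        (2 * Real.sqrt (2 * (32 * (2 * ((2 * ℓ₀ + r + 1 : ℕ) + 1 + ξ * d)) ^ d)) + 1) *
        Real.exp ((1 + 2 / δ) * Real.log (Real.sqrt Λ.card / Δ)) *
        (Real.exp (-β * E) * shellCount hh.isHermitian_sum E Δ) := by
  obtain ⟨hΔ, hΔn, hor⟩ := hw
  set hH := hh.isHermitian_sum
  set n : ℝ := (Λ.card : ℝ) with hn
  set M := Real.exp (-β * E) * shellCount hH E Δ with hMdef
  set B : ℝ := 32 * (2 * ((2 * ℓ₀ + r + 1 : ℕ) + 1 + ξ * d)) ^ d with hB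
  set q := Real.log (Real.sqrt n / Δ) with hq
  have hβ := nonneg_of_isShellMaximizer hΔ hmax
  have hn0 : 0 < n := by
    refine lt_of_le_of_ne (Nat.cast_nonneg _) fun h0 => ?_
    rw [← h0, Real.sqrt_zero, mul_zero] at hΔn
    linarith
  have hn1 : 1 ≤ n := Nat.one_le_cast.2 (Nat.cast_pos.1 hn0)
  have hB0 : 0 < B := by positivity
  have hsn : 0 < Real.sqrt n := Real.sqrt_pos.2 hn0
  have hΔs : Δ ≤ Real.sqrt n := hΔn.trans (by nlinarith)
  have hexpq : Real.exp q = Real.sqrt n / Δ := Real.exp_log (by positivity)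
  have hM0 : 0 ≤ M := by positivity
  have hq0 : 0 ≤ q := Real.log_nonneg ((one_le_div hΔ).2 hΔs)
  -- One bound for both alternatives of the width: the last factor dominates `n` when `Δ ≤
  -- n^((1-δ)/2)`, and `exp(1/δ)` dominates `exp(β * Δ)` otherwise.
  set W := 2 * Real.exp (1 / δ) * Real.exp (2 / δ * q) with hW
  have hwin : ∀ T : Finset (Config Λ),
      (∀ m ∈ T, ∀ m' ∈ T, hH.eigenvalues m' - Δ < hH.eigenvalues m) →
      ∑ m ∈ T, Real.exp (-β * hH.eigenvalues m) ≤ M * W := by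
    intro T hT
    have he1 : 1 ≤ Real.exp (1 / δ) := Real.one_le_exp (by positivity)
    have he2 : 1 ≤ Real.exp (2 / δ * q) := Real.one_le_exp (by positivity)
    rcases hor with hor | hor
    · refine (sum_exp_le_mul_card hmax T hT).trans (mul_le_mul_of_nonneg_left ?_ hM0)
      have h1 : n ^ (δ / 2) ≤ Real.exp q := by
        rw [hexpq, le_div_iff₀ hΔ]
        refine (mul_le_mul_of_nonneg_left hor (by positivity)).trans_eq ?_
        rw [← Real.rpow_add hn0, Real.sqrt_eq_rpow]
        congr 1
        ring
      have h2 : n ≤ Real.exp (2 / δ * q) := by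
        have h3 := Real.rpow_le_rpow (by positivity) h1 (z := 2 / δ) (by positivity)
        rw [← Real.rpow_mul hn0.le, ← Real.exp_mul, mul_comm q,
          show δ / 2 * (2 / δ) = 1 by field_simp, Real.rpow_one] at h3
        exact h3
      calc 1 + n ≤ 2 * 1 * Real.exp (2 / δ * q) := by linarith
        _ ≤ W := by rw [hW]; gcongr
    · refine (sum_exp_le_mul_exp hβ hmax T hT).trans (mul_le_mul_of_nonneg_left ?_ hM0)
      calc Real.exp (β * Δ) ≤ 1 * Real.exp (1 / δ) * 1 := by
            rw [one_mul, mul_one]; exact Real.exp_le_exp.2 hor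
        _ ≤ W := by rw [hW]; gcongr; exact one_le_two
  have hreal : avg (canonicalState (∑ i, h i) β) (∑ i, h i) =
      (((avg (canonicalState (∑ i, h i) β) (∑ i, h i)).re : ℝ) : ℂ) :=
    Complex.ext rfl (by rw [Complex.ofReal_im]; exact avg_canonicalState_im hH β hH)
  -- The energy variance is the moment bound with `p = 1`, applied to `H` itself.
  have hmom := hcl.norm_avg_canonicalState_pow_le hH hd hξ hh le_rfl
  rw [hreal, mul_one, pow_one, Nat.cast_one, mul_one, mul_one] at hmom
  have hvar := (Complex.re_le_norm _).trans hmom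
  have hV : 32 * (Λ.card : ℝ) * (2 * ((2 * ℓ₀ + r + 1 : ℕ) + 1 + ξ * d)) ^ d = B * n := by
    rw [hB]; ring
  rw [hV] at hvar
  refine (partitionFunction_le_of_variance_le hH hΔ (mul_pos hB0 hn0) hwin hvar).trans ?_
  have h1 : 1 ≤ Real.exp q := by rw [hexpq]; exact (one_le_div hΔ).2 hΔs
  have h2 : 2 * Real.sqrt (2 * (B * n)) / Δ + 1 ≤ (2 * Real.sqrt (2 * B) + 1) * Real.exp q := by
    rw [← mul_assoc, Real.sqrt_mul (by positivity), mul_div_assoc, mul_div_assoc, ← hexpq]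
    linarith
  calc 2 * (2 * Real.sqrt (2 * (B * n)) / Δ + 1) * (M * W)
      ≤ 2 * ((2 * Real.sqrt (2 * B) + 1) * Real.exp q) * (M * W) := by gcongr
    _ = _ := by
      rw [hW, add_mul 1 (2 / δ) q, one_mul, Real.exp_add]
      ring

end Shells

/-! ### Choice of the moment order, and equivalence of ensembles. -/

section Equivalence

/-- The moment comparison needs a power of two of order `q`. The least one above `q` is either `1`
or less than `2 * q`. -/
theorem exists_two_pow_between {q : ℝ} (hq : 0 ≤ q) :
    ∃ k : ℕ, q ≤ 2 ^ k ∧ (2 : ℝ) ^ k ≤ 1 + 2 * q := by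
  have hex : ∃ k : ℕ, q ≤ 2 ^ k := by
    obtain ⟨k, hk⟩ := pow_unbounded_of_one_lt q one_lt_two
    exact ⟨k, hk.le⟩
  classical
  refine ⟨Nat.find hex, Nat.find_spec hex, ?_⟩
  rcases h : Nat.find hex with _ | k
  · rw [pow_zero]; linarith
  · have := Nat.find_min hex (m := k) (by omega)
    rw [pow_succ]
    linarith

variable {d : ℕ} {L : Fin d → ℕ} {Λ : Finset (Site L)}

theorem isHermitian_sub_avg_smul_one {H A : Op Λ} (hH : H.IsHermitian) (β : ℝ)
    (hA : A.IsHermitian) : (A - avg (canonicalState H β) A • (1 : Op Λ)).IsHermitian := by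
  refine hA.sub ?_
  rw [Matrix.IsHermitian, Matrix.conjTranspose_smul, Matrix.conjTranspose_one, Complex.star_def,
    Complex.conj_eq_iff_im.2 (avg_canonicalState_im hH β hA)]

/-- The squared deviation of the microcanonical from the canonical average. -/
theorem norm_avg_microState_sub_sq_le {h ω : Λ → Op Λ} {ℓ₀ ℓ r : ℕ} {ξ β E Δ γ : ℝ}
    (hd : 1 ≤ d) (hh : IsLocalFamily h ℓ₀) (hω : IsLocalFamily ω ℓ) (hξ : 0 < ξ)
    (hΔ : 0 < Δ) (hmax : IsShellMaximizer hh.isHermitian_sum β E Δ)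
    (hcl : IsClustering r ξ (canonicalState (∑ i, h i) β)) {k : ℕ}
    (hK : partitionFunction hh.isHermitian_sum β ≤
      Real.exp (γ * 2 ^ k) * (Real.exp (-β * E) * shellCount hh.isHermitian_sum E Δ)) :
    ‖avg (microState hh.isHermitian_sum E Δ) (∑ i, ω i) -
        avg (canonicalState (∑ i, h i) β) (∑ i, ω i)‖ ^ 2 ≤
      Real.exp γ *
        (32 * Λ.card * 2 ^ k * (2 * ((2 * ℓ + r + 1 : ℕ) + 1 + ξ * 2 ^ k * d)) ^ d) := by
  have hH := hh.isHermitian_sum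
  have hN := shellCount_ne_zero_of_isShellMaximizer hΔ hmax
  have hβ := nonneg_of_isShellMaximizer hΔ hmax
  set A : Op Λ := ∑ i, ω i - avg (canonicalState (∑ i, h i) β) (∑ i, ω i) • (1 : Op Λ) with hA
  have hAh : A.IsHermitian := isHermitian_sub_avg_smul_one hH β hω.isHermitian_sum
  have hval : avg (microState hh.isHermitian_sum E Δ) A =
      avg (microState hh.isHermitian_sum E Δ) (∑ i, ω i) -
        avg (canonicalState (∑ i, h i) β) (∑ i, ω i) := by
    rw [hA, avg_sub, avg_smul, avg_microState_one _ hN, mul_one]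
  rw [← hval]
  have h1 := avg_microState_pow_le hh.isHermitian_sum hβ hN hAh k
  have h2 := (Complex.re_le_norm _).trans
    (hcl.norm_avg_canonicalState_pow_le hH hd hξ hω (Nat.one_le_two_pow (n := k)))
  rw [← hA, ← pow_succ'] at h2
  have hM : 0 < Real.exp (-β * E) * shellCount hh.isHermitian_sum E Δ :=
    mul_pos (Real.exp_pos _) (Nat.cast_pos.2 (Nat.pos_of_ne_zero hN))
  have h3 : partitionFunction hh.isHermitian_sum β /
      (Real.exp (-β * E) * shellCount hh.isHermitian_sum E Δ) ≤ Real.exp γ ^ 2 ^ k := by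
    rw [div_le_iff₀ hM, ← Real.exp_nat_mul]
    refine hK.trans_eq ?_
    push_cast
    rw [mul_comm γ]
  have h4 := h1.trans ((mul_le_mul_of_nonneg_left h2
    (div_nonneg (partitionFunction_pos _ _).le hM.le)).trans
    (mul_le_mul_of_nonneg_right h3 (by positivity)))
  -- Both sides are now powers with exponent `2^k`; taking the root turns the ratio of weights into
  -- the constant `exp γ`.
  rw [← mul_pow, pow_succ', pow_mul] at h4
  have h5 := le_of_pow_le_pow_left₀ (pow_pos two_pos k).ne' (by positivity) h4
  push_cast at h5 ⊢
  exact h5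

/-- Taking `p` of order `q = log(√n/Δ)` makes the loss `(Z/M)^(1/p)` a constant while `p` enters the
moment bound only polynomially. The maximum in the result reflects whether `p` or `ℓ` dominates the
lattice sum. -/
theorem exists_equivalence_constant (d : ℕ) (hd : 1 ≤ d) (r ℓ₀ : ℕ) (ξ : ℝ) (hξ : 0 < ξ)
    (δ : ℝ) (hδ : 0 < δ) (hδ' : δ < 1) :
    ∃ c : ℝ, 0 < c ∧
      ∀ (L : Fin d → ℕ) (Λ : Finset (Site L))
        (h : Λ → Op Λ) (hh : IsLocalFamily h ℓ₀)
        (ℓ : ℕ) (_ : r ≤ ℓ) (ω : Λ → Op Λ) (_ : IsLocalFamily ω ℓ)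
        (β E Δ : ℝ),
        AdmissibleWidth δ Λ.card β Δ →
        IsShellMaximizer hh.isHermitian_sum β E Δ →
        IsClustering r ξ (canonicalState (∑ i, h i) β) →
        ‖avg (microState hh.isHermitian_sum E Δ) ((Λ.card : ℂ)⁻¹ • ∑ i, ω i)
            - avg (canonicalState (∑ i, h i) β) ((Λ.card : ℂ)⁻¹ • ∑ i, ω i)‖ ≤
          1 / Real.sqrt Λ.card *
            max (c * Real.log (Real.sqrt Λ.card / Δ) ^ (((d : ℝ) + 1) / 2))
              (c * ((ℓ : ℝ) ^ d * Real.log (Real.sqrt Λ.card / Δ)) ^ ((1 : ℝ) / 2)) := by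
  set C : ℝ := 4 * Real.exp (1 / δ) *
    (2 * Real.sqrt (2 * (32 * (2 * ((2 * ℓ₀ + r + 1 : ℕ) + 1 + ξ * d)) ^ d)) + 1) with hC
  have hC1 : 1 ≤ C := by
    have h1 : 1 ≤ Real.exp (1 / δ) := Real.one_le_exp (by positivity)
    have h2 := Real.sqrt_nonneg (2 * (32 * (2 * ((2 * ℓ₀ + r + 1 : ℕ) + 1 + ξ * d)) ^ d))
    rw [hC]
    nlinarith
  -- A lower bound for `q`, from `Δ ≤ (1 - δ) √n`. It allows constants to be absorbed into multiples
  -- of `q`: the prefactor `C` in `γ`, and the `1` of `1 + 2 * q` in `η`.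
  set lam : ℝ := -Real.log (1 - δ) with hlam
  have hlam0 : 0 < lam := neg_pos.2 (Real.log_neg (by linarith) (by linarith))
  set γ : ℝ := Real.log C / lam + (1 + 2 / δ) with hγ
  have hγ0 : 0 ≤ γ := by
    have := Real.log_nonneg hC1
    positivity
  set η : ℝ := 2 + 1 / lam with hη
  have hη1 : 1 ≤ η := by
    have : 0 < 1 / lam := by positivity
    rw [hη]; linarith
  set c₀ : ℝ := 2 * (5 + ξ * d) with hc₀
  have hc₀0 : 0 < c₀ := by positivity
  set G : ℝ := Real.exp γ * 32 * (2 * c₀) ^ d * η ^ (d + 1) with hG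
  have hη0 : 0 < η := by linarith
  have hG0 : 0 < G := by positivity
  refine ⟨Real.sqrt G, Real.sqrt_pos.2 hG0, ?_⟩
  intro L Λ h hh ℓ hℓ ω hω β E Δ hw hmax hcl
  have hZ := partitionFunction_le_of_isClustering hd hh hξ hδ hw hmax hcl
  obtain ⟨hΔ, hΔn, -⟩ := hw
  set n : ℝ := (Λ.card : ℝ) with hn
  set q := Real.log (Real.sqrt n / Δ) with hq
  have hn0 : 0 < n := by
    refine lt_of_le_of_ne (Nat.cast_nonneg _) fun h0 => ?_
    rw [← h0, Real.sqrt_zero, mul_zero] at hΔn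
    linarith
  have hsn : 0 < Real.sqrt n := Real.sqrt_pos.2 hn0
  have hqlam : lam ≤ q := by
    have h1 : (1 - δ)⁻¹ ≤ Real.sqrt n / Δ := by
      rw [le_div_iff₀ hΔ, inv_mul_le_iff₀ (by linarith)]
      exact hΔn
    have h2 := Real.log_le_log (inv_pos.2 (by linarith)) h1
    rwa [Real.log_inv] at h2
  have hq0 : 0 < q := hlam0.trans_le hqlam
  obtain ⟨k, hk1, hk2⟩ := exists_two_pow_between hq0.le
  set p : ℝ := 2 ^ k with hp
  have hp1 : 1 ≤ p := one_le_pow₀ one_le_two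
  have hpη : p ≤ η * q := by
    refine hk2.trans ?_
    have : 1 ≤ 1 / lam * q := by rw [one_div, ← div_eq_inv_mul]; exact (one_le_div hlam0).2 hqlam
    rw [hη]; linarith
  have hK : partitionFunction hh.isHermitian_sum β ≤
      Real.exp (γ * 2 ^ k) * (Real.exp (-β * E) * shellCount hh.isHermitian_sum E Δ) := by
    refine hZ.trans (mul_le_mul_of_nonneg_right ?_ (by positivity))
    have h1 : C ≤ Real.exp (Real.log C / lam * q) := by
      rw [← Real.exp_log (zero_lt_one.trans_le hC1), Real.log_exp]
      refine Real.exp_le_exp.2 ?_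
      rw [div_mul_eq_mul_div, le_div_iff₀ hlam0]
      exact mul_le_mul_of_nonneg_left hqlam (Real.log_nonneg hC1)
    calc C * Real.exp ((1 + 2 / δ) * q)
        ≤ Real.exp (Real.log C / lam * q) * Real.exp ((1 + 2 / δ) * q) := by gcongr
      _ = Real.exp (γ * q) := by rw [← Real.exp_add, hγ, ← add_mul]
      _ ≤ Real.exp (γ * 2 ^ k) :=
        Real.exp_le_exp.2 (mul_le_mul_of_nonneg_left hk1 hγ0)
  have hsq := norm_avg_microState_sub_sq_le hd hh hω hξ hΔ hmax hcl hK
  set D := ‖avg (microState hh.isHermitian_sum E Δ) (∑ i, ω i) -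
        avg (canonicalState (∑ i, h i) β) (∑ i, ω i)‖ with hD
  set X := max (q ^ (d + 1)) ((ℓ : ℝ) ^ d * q) with hX
  -- Since `r ≤ ℓ` and `p ≥ 1`, the constant part `2ℓ + r + 2` is at most `5 max(ℓ, p)`; hence the 5
  -- in `c₀`.
  have hbase : 2 * (((2 * ℓ + r + 1 : ℕ) : ℝ) + 1 + ξ * p * d) ≤ 2 * c₀ * max (ℓ : ℝ) p := by
    have h1 : (r : ℝ) ≤ ℓ := Nat.cast_le.2 hℓ
    have h2 := le_max_left (ℓ : ℝ) p
    have h3 := le_max_right (ℓ : ℝ) p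
    have h4 : 0 ≤ ξ * d := by positivity
    have h5 := mul_le_mul_of_nonneg_left h3 h4
    have h6 : 0 ≤ ξ * d * max (ℓ : ℝ) p := by positivity
    rw [hc₀]
    push_cast
    nlinarith
  have hbound : p * (2 * (((2 * ℓ + r + 1 : ℕ) : ℝ) + 1 + ξ * p * d)) ^ d ≤
      (2 * c₀) ^ d * η ^ (d + 1) * X := by
    have hmaxpow : p * max (ℓ : ℝ) p ^ d ≤ η ^ (d + 1) * X := by
      rcases le_total (ℓ : ℝ) p with hlp | hlp
      · rw [max_eq_right hlp, ← pow_succ']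
        calc p ^ (d + 1) ≤ (η * q) ^ (d + 1) := by gcongr
          _ = η ^ (d + 1) * q ^ (d + 1) := mul_pow _ _ _
          _ ≤ η ^ (d + 1) * X := by gcongr; exact le_max_left _ _
      · rw [max_eq_left hlp]
        calc p * (ℓ : ℝ) ^ d ≤ η * q * (ℓ : ℝ) ^ d := by gcongr
          _ = η * ((ℓ : ℝ) ^ d * q) := by ring
          _ ≤ η ^ (d + 1) * X := by
            gcongr
            · exact le_self_pow₀ hη1 (Nat.succ_ne_zero d)
            · exact le_max_right _ _
    calc p * (2 * (((2 * ℓ + r + 1 : ℕ) : ℝ) + 1 + ξ * p * d)) ^ d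
        ≤ p * (2 * c₀ * max (ℓ : ℝ) p) ^ d := by gcongr
      _ = (2 * c₀) ^ d * (p * max (ℓ : ℝ) p ^ d) := by rw [mul_pow]; ring
      _ ≤ (2 * c₀) ^ d * (η ^ (d + 1) * X) := by gcongr
      _ = _ := by ring
  have hX0 : 0 ≤ X := le_max_of_le_left (by positivity)
  have hD2 : D ^ 2 ≤ n * (G * X) := by
    refine hsq.trans ?_
    calc Real.exp γ * (32 * n * p * (2 * (((2 * ℓ + r + 1 : ℕ) : ℝ) + 1 + ξ * p * d)) ^ d)
        = Real.exp γ * 32 * n *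
          (p * (2 * (((2 * ℓ + r + 1 : ℕ) : ℝ) + 1 + ξ * p * d)) ^ d) := by ring
      _ ≤ Real.exp γ * 32 * n * ((2 * c₀) ^ d * η ^ (d + 1) * X) := by gcongr
      _ = n * (G * X) := by rw [hG]; ring
  have hD1 : D ≤ Real.sqrt n * (Real.sqrt G * Real.sqrt X) := by
    rw [← Real.sqrt_mul hG0.le, ← Real.sqrt_mul hn0.le]
    exact Real.le_sqrt_of_sq_le hD2
  have hsqrtX : Real.sqrt X = max (q ^ (((d : ℝ) + 1) / 2)) (((ℓ : ℝ) ^ d * q) ^ ((1 : ℝ) / 2)) := by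
    rw [hX, Real.sqrt_monotone.map_max, ← Real.sqrt_eq_rpow, Real.sqrt_eq_rpow (q ^ (d + 1)),
      ← Real.rpow_natCast, ← Real.rpow_mul hq0.le]
    congr 2
    push_cast
    ring
  rw [avg_smul, avg_smul, ← mul_sub, norm_mul, norm_inv, Complex.norm_natCast, ← hn, ← hD,
    ← mul_max_of_nonneg _ _ (Real.sqrt_nonneg G), ← hsqrtX]
  calc n⁻¹ * D ≤ n⁻¹ * (Real.sqrt n * (Real.sqrt G * Real.sqrt X)) := by gcongr
    _ = 1 / Real.sqrt n * (Real.sqrt G * Real.sqrt X) := by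
      rw [← mul_assoc]
      congr 1
      nth_rewrite 1 [← Real.mul_self_sqrt hn0.le]
      field_simp

/-- Shells of exponentially small width still have an error term that vanishes for large `n`. -/
theorem exists_width_exponent (d : ℕ) {c : ℝ} (hc : 0 < c) (ℓ : ℕ) {ε : ℝ} (hε : 0 < ε) :
    ∃ a : ℝ, 0 < a ∧ ∃ n₀ : ℕ, ∀ n : ℕ, n₀ ≤ n → ∀ Δ : ℝ, 0 < Δ → Δ ≤ Real.sqrt n →
      Real.exp (-a * (n : ℝ) ^ (1 / ((d : ℝ) + 1))) ≤ Δ →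
      1 / Real.sqrt n * max (c * Real.log (Real.sqrt n / Δ) ^ (((d : ℝ) + 1) / 2))
        (c * ((ℓ : ℝ) ^ d * Real.log (Real.sqrt n / Δ)) ^ ((1 : ℝ) / 2)) ≤ ε := by
  have hd1 : (0 : ℝ) < (d : ℝ) + 1 := by positivity
  -- The first bound gives `(2a)^(d+1) ≤ 2a`; the second makes both `2a` and `2a ℓ^d` at most
  -- `(ε/c)^2`, as the two terms of the maximum require.
  set a : ℝ := min (1 / 2) ((min 1 (ε / c)) ^ 2 / (2 * ((ℓ : ℝ) ^ d + 1))) with ha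
  have hm0 : 0 < min 1 (ε / c) := lt_min one_pos (by positivity)
  have ha0 : 0 < a := lt_min (by norm_num) (by positivity)
  have ha1 : 2 * a ≤ 1 := by
    have : a ≤ 1 / 2 := min_le_left _ _
    linarith
  have ha2 : 2 * a * ((ℓ : ℝ) ^ d + 1) ≤ (ε / c) ^ 2 := by
    have h1 := min_le_right (1 / 2 : ℝ) ((min 1 (ε / c)) ^ 2 / (2 * ((ℓ : ℝ) ^ d + 1)))
    rw [← ha, le_div_iff₀ (by positivity)] at h1
    have h2 : (min 1 (ε / c)) ^ 2 ≤ (ε / c) ^ 2 := pow_le_pow_left₀ hm0.le (min_le_right _ _) 2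
    linarith
  have hlim : ∀ᶠ n : ℕ in Filter.atTop,
      Real.log (n : ℝ) ≤ 2 * a * (n : ℝ) ^ (1 / ((d : ℝ) + 1)) := by
    have h := (isLittleO_log_rpow_atTop (r := 1 / ((d : ℝ) + 1)) (by positivity)).comp_tendsto
      (tendsto_natCast_atTop_atTop (R := ℝ))
    filter_upwards [h.bound (show (0 : ℝ) < 2 * a by positivity)] with n hn
    simp only [Function.comp_apply] at hn
    rw [Real.norm_of_nonneg (Real.rpow_nonneg (Nat.cast_nonneg n) _)] at hn
    exact (le_abs_self _).trans hn
  obtain ⟨N, hN⟩ := Filter.eventually_atTop.1 hlim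
  refine ⟨a, ha0, max N 1, fun n hn Δ hΔ hΔn hwidth => ?_⟩
  have hn1 : (1 : ℝ) ≤ n := Nat.one_le_cast.2 ((le_max_right _ _).trans hn)
  have hn0 : (0 : ℝ) < n := by linarith
  have hsn : 0 < Real.sqrt n := Real.sqrt_pos.2 hn0
  set q := Real.log (Real.sqrt n / Δ) with hq
  set y : ℝ := (n : ℝ) ^ (1 / ((d : ℝ) + 1)) with hy
  have hy1 : 1 ≤ y := Real.one_le_rpow hn1 (by positivity)
  have hyn : y ≤ n := by
    conv_rhs => rw [← Real.rpow_one (n : ℝ)]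
    refine Real.rpow_le_rpow_of_exponent_le hn1 ?_
    rw [div_le_one hd1]
    linarith [(Nat.cast_nonneg d : (0 : ℝ) ≤ d)]
  have hq0 : 0 ≤ q := Real.log_nonneg ((one_le_div hΔ).2 hΔn)
  -- Half of the budget pays for `log √n`, which is eventually at most `a * y`; the other half pays
  -- for the width `exp(-a * y)`.
  have hqy : q ≤ 2 * a * y := by
    have h1 : -a * y ≤ Real.log Δ := by
      rw [← Real.log_exp (-a * y)]
      exact Real.log_le_log (Real.exp_pos _) hwidth
    have h2 := hN n ((le_max_left _ _).trans hn)
    rw [hq, Real.log_div hsn.ne' hΔ.ne', Real.log_sqrt hn0.le]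
    linarith
  have hsq : ∀ x : ℝ, 0 ≤ x → x ≤ (ε / c) ^ 2 * n →
      1 / Real.sqrt n * (c * Real.sqrt x) ≤ ε := by
    intro x _ hx
    have h1 : Real.sqrt x ≤ ε / c * Real.sqrt n := by
      refine Real.sqrt_le_iff.2 ⟨by positivity, ?_⟩
      rwa [mul_pow, Real.sq_sqrt hn0.le]
    calc 1 / Real.sqrt n * (c * Real.sqrt x)
        ≤ 1 / Real.sqrt n * (c * (ε / c * Real.sqrt n)) := by gcongr
      _ = ε := by field_simp
  have hℓ0 : (0 : ℝ) ≤ (ℓ : ℝ) ^ d := by positivity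
  have ha3 : 2 * a ≤ (ε / c) ^ 2 := by nlinarith
  rw [mul_max_of_nonneg _ _ (by positivity)]
  refine max_le ?_ ?_
  · have h1 : q ^ (((d : ℝ) + 1) / 2) = Real.sqrt (q ^ (d + 1)) := by
      rw [Real.sqrt_eq_rpow, ← Real.rpow_natCast, ← Real.rpow_mul hq0]
      congr 1
      push_cast
      ring
    rw [h1]
    refine hsq _ (by positivity) ?_
    have hyd : y ^ (d + 1) = n := by
      rw [hy, ← Real.rpow_natCast, ← Real.rpow_mul hn0.le]
      push_cast
      rw [one_div_mul_cancel hd1.ne', Real.rpow_one]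
    calc q ^ (d + 1) ≤ (2 * a * y) ^ (d + 1) := by gcongr
      _ = (2 * a) ^ (d + 1) * n := by rw [mul_pow, hyd]
      _ ≤ 2 * a * n := by
        gcongr
        exact pow_le_of_le_one (by positivity) ha1 (Nat.succ_ne_zero d)
      _ ≤ (ε / c) ^ 2 * n := by gcongr
  · rw [← Real.sqrt_eq_rpow]
    refine hsq _ (by positivity) ?_
    calc (ℓ : ℝ) ^ d * q ≤ (ℓ : ℝ) ^ d * (2 * a * n) := by
          gcongr
          exact hqy.trans (by gcongr)
      _ = 2 * a * (ℓ : ℝ) ^ d * n := by ring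
      _ ≤ (ε / c) ^ 2 * n := by gcongr; nlinarith

end Equivalence

theorem theorem2 (d : ℕ) (hd : 1 ≤ d) (r ℓ₀ : ℕ) (ξ : ℝ) (hξ : 0 < ξ)
    (δ : ℝ) (hδ : 0 < δ) (hδ' : δ < 1) :
    (∃ c₁ c₂ : ℝ, 0 < c₁ ∧ 0 < c₂ ∧
      ∀ (L : Fin d → ℕ) (Λ : Finset (Site L))
        (h : Λ → Op Λ) (hh : IsLocalFamily h ℓ₀)
        (ℓ : ℕ) (_ : r ≤ ℓ) (ω : Λ → Op Λ) (_ : IsLocalFamily ω ℓ)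
        (β E Δ : ℝ),
        AdmissibleWidth δ Λ.card β Δ →
        IsShellMaximizer hh.isHermitian_sum β E Δ →
        IsClustering r ξ (canonicalState (∑ i, h i) β) →
        ‖avg (microState hh.isHermitian_sum E Δ) ((Λ.card : ℂ)⁻¹ • ∑ i, ω i)
            - avg (canonicalState (∑ i, h i) β) ((Λ.card : ℂ)⁻¹ • ∑ i, ω i)‖ ≤
          1 / Real.sqrt Λ.card *
            max (c₁ * Real.log (Real.sqrt Λ.card / Δ) ^ (((d : ℝ) + 1) / 2))
              (c₂ * ((ℓ : ℝ) ^ d * Real.log (Real.sqrt Λ.card / Δ)) ^ ((1 : ℝ) / 2))) ∧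
    (∀ ℓ : ℕ, r ≤ ℓ → ∀ ε : ℝ, 0 < ε → ∃ a : ℝ, 0 < a ∧ ∃ n₀ : ℕ,
      ∀ (L : Fin d → ℕ) (Λ : Finset (Site L))
        (h : Λ → Op Λ) (hh : IsLocalFamily h ℓ₀)
        (ω : Λ → Op Λ) (_ : IsLocalFamily ω ℓ)
        (β E Δ : ℝ),
        n₀ ≤ Λ.card →
        Real.exp (-a * (Λ.card : ℝ) ^ (1 / ((d : ℝ) + 1))) ≤ Δ →
        AdmissibleWidth δ Λ.card β Δ →
        IsShellMaximizer hh.isHermitian_sum β E Δ →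
        IsClustering r ξ (canonicalState (∑ i, h i) β) →
        ‖avg (microState hh.isHermitian_sum E Δ) ((Λ.card : ℂ)⁻¹ • ∑ i, ω i)
            - avg (canonicalState (∑ i, h i) β) ((Λ.card : ℂ)⁻¹ • ∑ i, ω i)‖ ≤ ε) := by
  obtain ⟨c, hc, hmain⟩ := exists_equivalence_constant d hd r ℓ₀ ξ hξ δ hδ hδ'
  refine ⟨⟨c, c, hc, hc, hmain⟩, fun ℓ hℓ ε hε => ?_⟩
  obtain ⟨a, ha, n₀, hn₀⟩ := exists_width_exponent d hc ℓ hε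
  refine ⟨a, ha, n₀, fun L Λ h hh ω hω β E Δ hn hwidth hw hmax hcl => ?_⟩
  refine (hmain L Λ h hh ℓ hℓ ω hω β E Δ hw hmax hcl).trans ?_
  refine hn₀ Λ.card hn Δ hw.1 (hw.2.1.trans ?_) hwidth
  exact mul_le_of_le_one_left (Real.sqrt_nonneg _) (by linarith)
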